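/- For positive integers $d$ and $\lambda$ put $t=\sqrt{\lambda}$, $\kappa(d,\lambda)=(\lambda/d)^{1/2}$ and $S_t=\{x\in\mathbb{R}^d: |x|=t\}$, where $|\cdot|$ is the Euclidean norm. For $\xi\in\mathbb{T}^d=\mathbb{R}^d/\mathbb{Z}^d$ with $S_t\cap\mathbb{Z}^d\neq\emptyset$ let $$\mathfrak m_t(\xi)=\frac{1}{|S_t\cap\mathbb{Z}^d|}\sum_{x\in S_t\cap\mathbb{Z}^d}e^{2\pi i\,\xi\cdot x},$$ and let $\|\xi\|=\big(\sum_{j=1}^d\operatorname{dist}(\xi_j,\mathbb{Z})^2\big)^{1/2}$ and $\mathbf 1=(1,\dots,1)$. There exist universal constants $C,c,K>0$ such that for all integers $d\ge 16$, all integers $\lambda\ge C d^3$, and all $\xi\in\mathbb{T}^d$, $$|\mathfrak m_t(\xi)|\le K\Big(e^{-2\pi\kappa(d,\lambda)\|\xi\|}+e^{-2\pi\kappa(d,\lambda)\|\xi+\mathbf 1/2\|}+\lambda^{-2}+e^{-cd}\Big).$$ -/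

import Mathlib

namespace DiscreteSphere

/-- The lattice points of `ℤ^d` on the sphere `S_t` of radius `t` centred at the origin of the
Euclidean space `ℝ^d`, that is, `S_t ∩ ℤ^d`. -/
def latticeSphereSet (d : ℕ) (t : ℝ) : Set (Fin d → ℤ) :=
  {x | WithLp.toLp 2 (fun j => (x j : ℝ)) ∈ Metric.sphere (0 : EuclideanSpace ℝ (Fin d)) t}

theorem latticeSphereSet_finite (d : ℕ) (t : ℝ) : (latticeSphereSet d t).Finite := by
  have h : (Set.pi Set.univ fun _ : Fin d => Set.Icc (-⌈t⌉) ⌈t⌉).Finite :=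
    Set.Finite.pi fun _ => Set.finite_Icc _ _
  refine h.subset fun x hx j _ => ?_
  have hx' : ‖WithLp.toLp 2 (fun j => (x j : ℝ))‖ = t := by
    simpa [latticeSphereSet] using hx
  have h1 : |(x j : ℝ)| ≤ t := by
    have := PiLp.norm_apply_le (WithLp.toLp 2 (fun j => (x j : ℝ))) j
    rw [hx'] at this
    simpa using this
  have h2 : |(x j : ℝ)| ≤ (⌈t⌉ : ℝ) := h1.trans (Int.le_ceil t)
  have h3 : |x j| ≤ ⌈t⌉ := by exact_mod_cast h2
  exact abs_le.mp h3

/-- `S_t ∩ ℤ^d` as a finite set. -/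
noncomputable def latticeSphere (d : ℕ) (t : ℝ) : Finset (Fin d → ℤ) :=
  (latticeSphereSet_finite d t).toFinset

/-- The multiplier `𝔪_t(ξ) = |S_t ∩ ℤ^d|⁻¹ ∑_{x ∈ S_t ∩ ℤ^d} e^{2πi ξ·x}` for `ξ` in the torus
`𝕋^d = (ℝ/ℤ)^d`; the character `ξ ↦ e^{2πi ξ·x}` is `UnitAddTorus.mFourier x`. -/
noncomputable def multiplier (d : ℕ) (t : ℝ) (ξ : UnitAddTorus (Fin d)) : ℂ :=
  (1 / ((latticeSphere d t).card : ℂ)) * ∑ x ∈ latticeSphere d t, UnitAddTorus.mFourier x ξ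

/-- `‖ξ‖ = (‖ξ_1‖² + ⋯ + ‖ξ_d‖²)^{1/2}` on `𝕋^d`, where `‖ξ_j‖ = dist(ξ_j, ℤ)` is the norm
of `ℝ/ℤ`. (The norm that `UnitAddTorus` carries as a product is the maximum instead.) -/
noncomputable def torusNorm {d : ℕ} (ξ : UnitAddTorus (Fin d)) : ℝ :=
  Real.sqrt (∑ j, ‖ξ j‖ ^ 2)

/-- The point `𝟏/2 = (1/2, …, 1/2)` of `𝕋^d`. -/
noncomputable def halfVector (d : ℕ) : UnitAddTorus (Fin d) :=
  fun _ => ((1 / 2 : ℝ) : UnitAddCircle)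

/-- The proportionality constant `κ(d, λ) = (λ/d)^{1/2}`. -/
noncomputable def kappa (d l : ℕ) : ℝ :=
  Real.sqrt ((l : ℝ) / (d : ℝ))

end DiscreteSphere

/-! The proof is a circle method with a saddle point. Orthogonality on a period of length 2 writes
the exponential sum over the sphere as half the integral of `e^{-πiλτ} ∏ⱼ θ(ξ_j, τ)`, `τ = x + iy`,
`-1/2 ≤ x ≤ 3/2`, for any `y > 0` (`sum_latticeSphere_eq_integral`). The multiplier is the ratio of
this integral at `ξ` to the one at `0`, and `y = d/(2πλ)` puts the saddle point of the latter at `x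
= 0`.

Away from the integers, `SL(2, ℤ)`-invariance gives `|θ(u, τ)| ≤ (13/11)|cτ + e|^{-1/2}` for some
coprime `(c, e)`, uniformly in real `u`. At distance at least `y` from the integers `|cτ + e|² ≥
2y²`, and `(13/11)⁴ < 2`, so every factor `√y |θ|` is at most some `ρ < 1`. All but eight factors
are bounded by `ρ`; the other eight are averaged through an Eisenstein-type sum, which supplies the
factor `y` that makes the bound uniform in `λ` (`exists_setIntegral_farSet_le`).

Near `0`, the inversion `τ ↦ -1/τ` makes `θ(u, τ)` essentially one Gaussian in `dist(u, ℤ)`; near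
`1`, `θ(u, τ + 1) = θ(u + 1/2, τ)` reduces to the same estimate at `ξ + 𝟏/2`. The condition `λ ≥
4d³` keeps the relative error per factor below `d⁻²`, so that `d` factors lose only a constant. At
`ξ = 0` the arc around `0` also gives a lower bound of order `y/√d` for the denominator. In the
quotient, `exp(-(πκ‖ξ‖)²/2)` is weakened to a multiple of `exp(-2πκ‖ξ‖)`. This settles large `d`
without the term `λ⁻²`; for bounded `d`, `|𝔪_t| ≤ 1` suffices. -/

namespace DiscreteSphere

/-! ### Modular transformations of theta functions with real characteristics. -/

open Complex in
theorem jacobiTheta₂_add_one (z τ : ℂ) :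
    jacobiTheta₂ z (τ + 1) = jacobiTheta₂ (z + 1 / 2) τ := by
  refine tsum_congr fun n => ?_
  -- Since `n² ≡ n` modulo 2, `e^{πi n²} = e^{πi n}`, which is a half-period shift of `z`.
  have hn : Even (n ^ 2 - n) := by
    have := Int.even_mul_succ_self (n - 1)
    convert this using 1
    ring
  obtain ⟨k, hk⟩ := hn
  have hk' : (n : ℂ) ^ 2 = n + 2 * k := by
    have : n ^ 2 = n + 2 * k := by omega
    exact_mod_cast this
  rw [jacobiTheta₂_term, jacobiTheta₂_term, Complex.exp_eq_exp_iff_exists_int]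
  refine ⟨k, ?_⟩
  linear_combination (Real.pi * I) * hk'

/-- The theta function with real characteristics `a, b`, that is
`∑ₙ exp (π i (n + a)² τ + 2 π i (n + a) b)` up to a factor of modulus one. -/
noncomputable def thetaChar (a b : ℝ) (τ : ℂ) : ℂ :=
  Complex.exp (Real.pi * Complex.I * τ * a ^ 2) * jacobiTheta₂ (b + a * τ) τ

theorem norm_thetaChar (a b : ℝ) (τ : ℂ) :
    ‖thetaChar a b τ‖ = Real.exp (-Real.pi * a ^ 2 * τ.im) * ‖jacobiTheta₂ (b + a * τ) τ‖ := by
  rw [thetaChar, norm_mul, Complex.norm_exp]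
  congr 2
  have : (Real.pi * Complex.I * τ * a ^ 2 : ℂ) = ((Real.pi * a ^ 2 : ℝ) : ℂ) * (Complex.I * τ) := by
    push_cast; ring
  rw [this, Complex.re_ofReal_mul]
  simp

theorem thetaChar_zero_left (b : ℝ) (τ : ℂ) : thetaChar 0 b τ = jacobiTheta₂ b τ := by
  simp [thetaChar]

theorem norm_thetaChar_add_one (a b : ℝ) (τ : ℂ) :
    ‖thetaChar a b (τ + 1)‖ = ‖thetaChar a (b + a + 1 / 2) τ‖ := by
  rw [norm_thetaChar, norm_thetaChar, jacobiTheta₂_add_one]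
  simp only [Complex.add_im, Complex.one_im, add_zero]
  congr 3
  push_cast
  ring

/-- Completing the square in the functional equation leaves only a unimodular factor; squaring
removes the root, as `‖(-iτ)^{1/2}‖² = ‖τ‖`. -/
theorem norm_thetaChar_inv (a b : ℝ) {τ : ℂ} (hτ : τ ≠ 0) :
    ‖thetaChar a b τ‖ ^ 2 * ‖τ‖ = ‖thetaChar (-b) a (-1 / τ)‖ ^ 2 := by
  have key : thetaChar a b τ = 1 / (-Complex.I * τ) ^ (1 / 2 : ℂ) *
      (Complex.exp (((-2 * Real.pi * a * b : ℝ) : ℂ) * Complex.I) *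
      thetaChar (-b) a (-1 / τ)) := by
    rw [thetaChar, thetaChar, jacobiTheta₂_functional_equation]
    have h1 : ((b : ℂ) + a * τ) / τ = a + ((-b : ℝ) : ℂ) * (-1 / τ) := by
      push_cast; field_simp; ring
    rw [h1]
    have h2 : Complex.exp (Real.pi * Complex.I * τ * a ^ 2) *
        Complex.exp (-Real.pi * Complex.I * (b + a * τ) ^ 2 / τ) =
        Complex.exp (((-2 * Real.pi * a * b : ℝ) : ℂ) * Complex.I) *
        Complex.exp (Real.pi * Complex.I * (-1 / τ) * ((-b : ℝ) : ℂ) ^ 2) := by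
      rw [← Complex.exp_add, ← Complex.exp_add]
      congr 1
      push_cast; field_simp; ring
    linear_combination (1 / (-Complex.I * τ) ^ (1 / 2 : ℂ) *
      jacobiTheta₂ (a + ((-b : ℝ) : ℂ) * (-1 / τ)) (-1 / τ)) * h2
  have hn : ‖(-Complex.I * τ) ^ (1 / 2 : ℂ)‖ ^ 2 = ‖τ‖ := by
    rw [← norm_pow, ← Complex.cpow_nat_mul]
    simp
  rw [key, norm_mul, norm_mul, Complex.norm_exp_ofReal_mul_I, one_mul, mul_pow, norm_div, norm_one,
    div_pow, hn]
  have : ‖τ‖ ≠ 0 := norm_ne_zero_iff.mpr hτ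
  field_simp

/-- `M` bounds the `SL(2, ℤ)`-invariant quantity `‖θ[a, b](τ)‖⁴ Im τ` for all real
characteristics. -/
def ThetaBound (M : ℝ) (τ : UpperHalfPlane) : Prop :=
  ∀ a b : ℝ, ‖thetaChar a b τ‖ ^ 4 * τ.im ≤ M

-- The translation acts on characteristics by the bijection `(a, b) ↦ (a, b + a + 1/2)`, which the
-- quantifier over all of them absorbs.
open UpperHalfPlane ModularGroup MatrixGroups in
theorem thetaBound_T_smul (M : ℝ) (τ : ℍ) : ThetaBound M (T • τ) ↔ ThetaBound M τ := by
  have hco : ((T • τ : ℍ) : ℂ) = (τ : ℂ) + 1 := by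
    rw [UpperHalfPlane.modular_T_smul, coe_vadd]; push_cast; ring
  have him : (T • τ : ℍ).im = τ.im := by
    rw [← UpperHalfPlane.coe_im, hco]; simp
  simp only [ThetaBound, hco, him, norm_thetaChar_add_one]
  constructor
  · intro h a b
    have := h a (b - a - 1 / 2)
    rwa [show b - a - 1 / 2 + a + 1 / 2 = b by ring] at this
  · exact fun h a b => h _ _

-- The inversion permutes characteristics, and the factor `‖τ‖²` gained by `‖θ‖⁴` cancels the change
-- of the imaginary part.
open UpperHalfPlane ModularGroup MatrixGroups in
theorem thetaBound_S_smul (M : ℝ) (τ : ℍ) : ThetaBound M (S • τ) ↔ ThetaBound M τ := by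
  have hco : ((S • τ : ℍ) : ℂ) = -1 / (τ : ℂ) := by
    rw [UpperHalfPlane.modular_S_smul]; simp [neg_div, inv_neg]
  have h0 : (τ : ℂ) ≠ 0 := τ.ne_zero
  have hn : ‖(τ : ℂ)‖ ≠ 0 := norm_ne_zero_iff.mpr h0
  have him : (S • τ : ℍ).im * ‖(τ : ℂ)‖ ^ 2 = τ.im := by
    rw [← UpperHalfPlane.coe_im, hco, ← Complex.normSq_eq_norm_sq, Complex.div_im]
    have : Complex.normSq (τ : ℂ) ≠ 0 := by simpa using h0
    simp
    field_simp
  have h (a b : ℝ) : ‖thetaChar (-b) a (S • τ : ℍ)‖ ^ 4 * (S • τ : ℍ).im =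
      ‖thetaChar a b τ‖ ^ 4 * τ.im := by
    have := norm_thetaChar_inv a b h0
    rw [hco, ← him]
    rw [show ∀ x : ℝ, x ^ 4 = (x ^ 2) ^ 2 by intro x; ring, ← this]
    ring
  constructor
  · intro H a b
    rw [← h]; exact H _ _
  · intro H a b
    rw [← neg_neg a, h]; exact H _ _

open UpperHalfPlane ModularGroup MatrixGroups in
theorem thetaBound_smul (M : ℝ) (g : SL(2, ℤ)) (τ : ℍ) :
    ThetaBound M (g • τ) ↔ ThetaBound M τ := by
  have hg : g ∈ Subgroup.closure {S, T} := by
    rw [SpecialLinearGroup.SL2Z_generators]; trivial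
  induction hg using Subgroup.closure_induction generalizing τ with
  | mem x hx =>
    rcases hx with rfl | rfl
    · exact thetaBound_S_smul M τ
    · exact thetaBound_T_smul M τ
  | one => simp
  | mul x y _ _ hx hy =>
    rw [mul_smul]
    exact (hx _).trans (hy _)
  | inv x _ hx =>
    have h := hx (x⁻¹ • τ)
    rw [smul_inv_smul] at h
    exact h.symm

/-! ### Gaussian sums and the theta bound coming from the fundamental domain. -/

/-- On the imaginary axis the terms at `b = 0` are positive, and a real `b` only introduces phases.
-/
theorem norm_jacobiTheta₂_ofReal_le (b : ℝ) {y : ℝ} (hy : 0 < y) :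
    ‖jacobiTheta₂ b (Complex.I * y)‖ ≤ ‖jacobiTheta₂ 0 (Complex.I * y)‖ := by
  have hτ : 0 < (Complex.I * y).im := by simpa using hy
  have hs (z : ℂ) := (hasSum_jacobiTheta₂_term z hτ)
  have h0 : ∀ n : ℤ, jacobiTheta₂_term n 0 (Complex.I * y) =
      ((Real.exp (-Real.pi * n ^ 2 * y) : ℝ) : ℂ) := by
    intro n
    rw [jacobiTheta₂_term, Complex.ofReal_exp]
    congr 1
    push_cast
    linear_combination (Real.pi * n ^ 2 * y : ℂ) * Complex.I_sq
  have hn : ∀ n : ℤ, ‖jacobiTheta₂_term n b (Complex.I * y)‖ =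
      Real.exp (-Real.pi * n ^ 2 * y) := by
    intro n
    rw [norm_jacobiTheta₂_term]; simp
  have hsum : Summable fun n : ℤ => Real.exp (-Real.pi * n ^ 2 * y) := by
    simpa only [hn] using (hs b).summable.norm
  have e0 : jacobiTheta₂ 0 (Complex.I * y) =
      ((∑' n : ℤ, Real.exp (-Real.pi * n ^ 2 * y) : ℝ) : ℂ) := by
    rw [jacobiTheta₂, Complex.ofReal_tsum]
    exact tsum_congr h0
  rw [e0, Complex.norm_real, Real.norm_of_nonneg (tsum_nonneg fun _ => (Real.exp_pos _).le),
    jacobiTheta₂]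
  refine (norm_tsum_le_tsum_norm (hs b).summable.norm).trans ?_
  simp only [hn, le_refl]

theorem norm_thetaChar_le_tsum (a b : ℝ) {τ : ℂ} (hτ : 0 < τ.im) :
    Summable (fun n : ℤ => Real.exp (-Real.pi * (n + a) ^ 2 * τ.im)) ∧
    ‖thetaChar a b τ‖ ≤ ∑' n : ℤ, Real.exp (-Real.pi * (n + a) ^ 2 * τ.im) := by
  have hs := (hasSum_jacobiTheta₂_term (b + a * τ) hτ).summable.norm
  have hn : ∀ n : ℤ, Real.exp (-Real.pi * a ^ 2 * τ.im) *
      ‖jacobiTheta₂_term n (b + a * τ) τ‖ = Real.exp (-Real.pi * (n + a) ^ 2 * τ.im) := by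
    intro n
    rw [norm_jacobiTheta₂_term, ← Real.exp_add]
    congr 1
    simp
    ring
  refine ⟨?_, ?_⟩
  · exact (hs.mul_left (Real.exp (-Real.pi * a ^ 2 * τ.im))).congr hn
  · rw [norm_thetaChar, jacobiTheta₂]
    simp only [← hn]
    rw [tsum_mul_left]
    gcongr
    exact norm_tsum_le_tsum_norm hs

/-- Shifting a Gaussian does not increase its sum over the integers. -/
theorem tsum_gaussian_shift_le (a : ℝ) {y : ℝ} (hy : 0 < y) :
    ∑' n : ℤ, Real.exp (-Real.pi * (n + a) ^ 2 * y) ≤ ‖jacobiTheta (Complex.I * y)‖ := by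
  have hy0 : (y : ℂ) ≠ 0 := by exact_mod_cast hy.ne'
  have hI : -1 / (Complex.I * y) = Complex.I * ((1 / y : ℝ) : ℂ) := by
    push_cast
    field_simp
    simp
  have hne : Complex.I * (y : ℂ) ≠ 0 := mul_ne_zero Complex.I_ne_zero hy0
  -- Inversion (Poisson summation) turns the shift `a` into a phase, where the preceding bound
  -- applies.
  have h1 := norm_thetaChar_inv a 0 hne
  have h2 := norm_thetaChar_inv 0 0 hne
  rw [hI] at h1 h2
  simp only [neg_zero, thetaChar_zero_left] at h1 h2
  have h3 := norm_jacobiTheta₂_ofReal_le a (y := 1 / y) (by positivity)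
  have hnorm : 0 < ‖Complex.I * (y : ℂ)‖ := norm_pos_iff.mpr hne
  have h4 : ‖thetaChar a 0 (Complex.I * y)‖ ≤ ‖jacobiTheta₂ 0 (Complex.I * y)‖ := by
    have : ‖thetaChar a 0 (Complex.I * y)‖ ^ 2 * ‖Complex.I * (y : ℂ)‖ ≤
        ‖jacobiTheta₂ 0 (Complex.I * y)‖ ^ 2 * ‖Complex.I * (y : ℂ)‖ := by
      rw [h1]
      simp only [Complex.ofReal_zero] at h2
      rw [h2]
      gcongr
    exact le_of_sq_le_sq (le_of_mul_le_mul_right this hnorm) (norm_nonneg _)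
  rw [jacobiTheta_eq_jacobiTheta₂]
  refine le_trans (le_of_eq ?_) h4
  have hn : ∀ n : ℤ, Complex.exp (Real.pi * Complex.I * (Complex.I * y) * a ^ 2) *
      jacobiTheta₂_term n ((0 : ℝ) + a * (Complex.I * y)) (Complex.I * y) =
      ((Real.exp (-Real.pi * (n + a) ^ 2 * y) : ℝ) : ℂ) := by
    intro n
    rw [jacobiTheta₂_term, ← Complex.exp_add, Complex.ofReal_exp]
    congr 1
    push_cast
    linear_combination (Real.pi * (n + a) ^ 2 * y : ℂ) * Complex.I_sq
  rw [thetaChar, jacobiTheta₂, ← tsum_mul_left]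
  simp only [hn]
  rw [← Complex.ofReal_tsum, Complex.norm_real,
    Real.norm_of_nonneg (tsum_nonneg fun _ => (Real.exp_pos _).le)]

theorem norm_thetaChar_le_of_three_le (a b : ℝ) {τ : ℂ} (hτ : 0 < τ.im)
    (h : 3 ≤ 4 * τ.im ^ 2) : ‖thetaChar a b τ‖ ≤ 13 / 11 := by
  refine (norm_thetaChar_le_tsum a b hτ).2.trans ((tsum_gaussian_shift_le a hτ).trans ?_)
  have h1 := norm_jacobiTheta_sub_one_le (τ := Complex.I * τ.im) (by simpa using hτ)
  have h2 : ‖jacobiTheta (Complex.I * τ.im)‖ ≤ 1 + ‖jacobiTheta (Complex.I * τ.im) - 1‖ := by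
    simpa using norm_add_le 1 (jacobiTheta (Complex.I * τ.im) - 1)
  have him : (Complex.I * (τ.im : ℂ)).im = τ.im := by simp
  rw [him] at h1
  -- With `q = e^{-π Im τ}`, `q ≤ e^{-5/2} ≤ 1/12` gives `1 + 2q/(1 - q) ≤ 13/11`.
  have h3 : Real.exp (-Real.pi * τ.im) ≤ 1 / 12 := by
    have hpi := Real.pi_gt_d2
    have ht : 0.86 ≤ τ.im := by nlinarith
    have : Real.exp (-Real.pi * τ.im) ≤ Real.exp (-(5 / 2)) :=
      Real.exp_le_exp.mpr (by nlinarith)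
    refine this.trans ?_
    rw [Real.exp_neg, ← one_div]
    apply one_div_le_one_div_of_le (by norm_num)
    have h5 : Real.exp (5 / 2) ^ 2 = Real.exp 1 ^ 5 := by
      rw [← Real.exp_nat_mul, ← Real.exp_nat_mul]; norm_num
    have h6 : (2.71 : ℝ) ^ 5 ≤ Real.exp 1 ^ 5 := by
      have := Real.exp_one_gt_d9
      gcongr
      linarith
    refine le_of_sq_le_sq (h5 ▸ (le_trans ?_ h6)) (Real.exp_pos _).le
    norm_num
  have h4 : 2 / (1 - Real.exp (-Real.pi * τ.im)) * Real.exp (-Real.pi * τ.im) ≤ 2 / 11 := by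
    rw [div_mul_eq_mul_div, div_le_div_iff₀ (by linarith) (by norm_num)]
    linarith
  linarith

open UpperHalfPlane ModularGroup MatrixGroups in
/-- For every `τ` there is a coprime pair `(c, e)` with
`|θ(x, τ)| ≤ (13 / 11) |c τ + e|^(-1/2)` for all real `x`. -/
theorem exists_coprime_norm_jacobiTheta₂_le (τ : ℍ) :
    ∃ c e : ℤ, IsCoprime c e ∧
      ∀ x : ℝ, ‖jacobiTheta₂ x τ‖ ^ 4 * Complex.normSq (c * τ + e) ≤ (13 / 11) ^ 4 := by
  obtain ⟨g, hg⟩ := exists_smul_mem_fd τ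
  have him := ModularGroup.im_smul_eq_div_normSq g τ
  refine ⟨g 1 0, g 1 1, ?_, fun x => ?_⟩
  · have := Matrix.SpecialLinearGroup.det_coe g
    rw [Matrix.det_fin_two] at this
    exact ⟨-g 0 1, g 0 0, by linear_combination this⟩
  -- The bound at `g • τ` in the fundamental domain is carried back to `τ`, using `Im (gτ) = Im τ /
  -- |cτ + e|²` with `(c, e)` the bottom row of `g`.
  · have hb : ThetaBound ((13 / 11) ^ 4 * (g • τ).im) (g • τ) := by
      intro a b
      have := norm_thetaChar_le_of_three_le a b (τ := ((g • τ : ℍ) : ℂ)) (g • τ).im_pos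
        (three_le_four_mul_im_sq_of_mem_fd hg)
      have h0 := (g • τ).im_pos.le
      gcongr
    rw [thetaBound_smul] at hb
    have h1 := hb 0 x
    rw [thetaChar_zero_left, him] at h1
    have hd : Complex.normSq (denom (g : GL (Fin 2) ℝ) τ) =
        Complex.normSq (((g 1 0 : ℤ) : ℂ) * τ + (g 1 1 : ℤ)) := by
      simp [denom]
    have hpos : 0 < Complex.normSq (denom (g : GL (Fin 2) ℝ) τ) := normSq_denom_pos _ τ.im_ne_zero
    rw [← hd]
    have ht := τ.im_pos
    rw [mul_div_assoc', le_div_iff₀ hpos] at h1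
    refine le_of_mul_le_mul_right ?_ ht
    nlinarith [h1]

/-! ### Averaging the Eisenstein-type sum by unfolding. -/

open MeasureTheory Set

/-- The Eisenstein-type sum `∑_{c ≥ 1} ∑_{e ∈ ℤ} |c (x + i y) + e|⁻⁴`. -/
noncomputable def quarticSum (y x : ℝ) : ENNReal :=
  ∑' c : ℕ, ∑' e : ℤ, ENNReal.ofReal (1 / ((((c : ℝ) + 1) * x + e) ^ 2 + (((c : ℝ) + 1) * y) ^ 2) ^ 2)

theorem measurable_quarticSum (y : ℝ) : Measurable (quarticSum y) := by
  unfold quarticSum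
  refine Measurable.tsum fun c => Measurable.tsum fun e => ?_
  fun_prop

/-- The sum counts the integers in `[k(x - b), k(x - a)]`, an interval of length `(b - a)k`. -/
theorem tsum_indicator_shift_le (a b : ℝ) (hab : a ≤ b) (k : ℕ) (hk : 0 < k) (x : ℝ) :
    ∑' e : ℤ, (Icc a b).indicator (1 : ℝ → ENNReal) (x - e / k) ≤
      ENNReal.ofReal ((b - a) * k + 1) := by
  have hk' : (0 : ℝ) < k := by exact_mod_cast hk
  have hmem : ∀ e : ℤ, x - e / k ∈ Icc a b ↔ e ∈ Finset.Icc ⌈k * (x - b)⌉ ⌊k * (x - a)⌋ := by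
    intro e
    rw [Finset.mem_Icc, Int.ceil_le, Int.le_floor, mem_Icc]
    have : (e : ℝ) = k * (e / k) := by field_simp
    constructor
    · rintro ⟨h1, h2⟩
      rw [this]
      constructor <;> gcongr <;> linarith
    · rintro ⟨h1, h2⟩
      rw [this] at h1 h2
      have h3 := le_of_mul_le_mul_left h1 hk'
      have h4 := le_of_mul_le_mul_left h2 hk'
      constructor <;> linarith
  rw [tsum_eq_sum (s := Finset.Icc ⌈k * (x - b)⌉ ⌊k * (x - a)⌋)]
  · have h1 : ∀ e ∈ Finset.Icc ⌈k * (x - b)⌉ ⌊k * (x - a)⌋,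
        (Icc a b).indicator (1 : ℝ → ENNReal) (x - e / k) ≤ 1 :=
      fun e _ => indicator_le_self' (f := (1 : ℝ → ENNReal)) (by simp) _
    refine (Finset.sum_le_card_nsmul _ _ _ h1).trans ?_
    rw [nsmul_eq_mul, mul_one, Int.card_Icc]
    have h0 : 0 ≤ (b - a) * k + 1 := by
      have := sub_nonneg.mpr hab
      positivity
    rw [← ENNReal.ofReal_natCast]
    apply ENNReal.ofReal_le_ofReal
    have h1 := Int.floor_le (k * (x - a))
    have h2 := Int.le_ceil (k * (x - b))
    rcases le_total 0 (⌊k * (x - a)⌋ + 1 - ⌈k * (x - b)⌉) with h | h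
    · have h3 : (((⌊k * (x - a)⌋ + 1 - ⌈k * (x - b)⌉).toNat : ℤ) : ℝ) =
          ((⌊k * (x - a)⌋ + 1 - ⌈k * (x - b)⌉ : ℤ) : ℝ) := by
        rw [Int.toNat_of_nonneg h]
      rw [Int.cast_natCast] at h3
      rw [h3]
      push_cast
      linarith
    · rw [Int.toNat_of_nonpos h]
      simpa using h0
  · intro e he
    rw [← hmem] at he
    exact indicator_of_notMem he _

/-- Unfolding: translates of `g` by the multiples of `1 / k`, integrated over `[a, b]`. -/
theorem lintegral_tsum_shift_le {g : ℝ → ENNReal} (hg : Measurable g) (a b : ℝ) (hab : a ≤ b)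
    (k : ℕ) (hk : 0 < k) :
    ∫⁻ x in Icc a b, ∑' e : ℤ, g (x + e / k) ≤ ENNReal.ofReal ((b - a) * k + 1) * ∫⁻ x, g x := by
  have hm : ∀ e : ℤ, Measurable fun x : ℝ => (Icc a b).indicator (1 : ℝ → ENNReal) (x - e / k) :=
    fun e => (measurable_one.indicator measurableSet_Icc).comp (measurable_id.sub_const _)
  have hg' : ∀ e : ℤ, Measurable fun x : ℝ => g (x + e / k) :=
    fun e => hg.comp (measurable_id.add_const _)
  rw [lintegral_tsum fun e => (hg' e).aemeasurable]
  have : ∀ e : ℤ, ∫⁻ x in Icc a b, g (x + e / k) =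
      ∫⁻ x, (Icc a b).indicator (1 : ℝ → ENNReal) (x - e / k) * g x := by
    intro e
    rw [← lintegral_indicator measurableSet_Icc,
      ← lintegral_add_right_eq_self (fun x => _ * _) ((e : ℝ) / k)]
    congr 1
    funext x
    by_cases hx : x ∈ Icc a b <;> simp [hx]
  simp only [this]
  have hm' : ∀ e : ℤ, Measurable fun x : ℝ =>
      (Icc a b).indicator (1 : ℝ → ENNReal) (x - e / k) * g x := fun e => (hm e).mul hg
  rw [← lintegral_tsum fun e => (hm' e).aemeasurable]
  rw [← lintegral_const_mul _ hg]
  refine lintegral_mono fun x => ?_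
  rw [ENNReal.tsum_mul_right]
  gcongr
  exact tsum_indicator_shift_le a b hab k hk x

/-- The inequality `(x² + y²)² ≥ y²(x² + y²)` reduces this to the integral of `1/(1 + x²)`. -/
theorem lintegral_inv_sq_add_sq_sq_le {y : ℝ} (hy : 0 < y) :
    ∫⁻ x : ℝ, ENNReal.ofReal (1 / (x ^ 2 + y ^ 2) ^ 2) ≤ ENNReal.ofReal (Real.pi / y ^ 3) := by
  have hi : Integrable (fun x : ℝ => y⁻¹ ^ 4 * (1 + (y⁻¹ * x) ^ 2)⁻¹) :=
    (integrable_inv_one_add_sq.comp_mul_left' (inv_ne_zero hy.ne')).const_mul _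
  have hI : ∫ x : ℝ, y⁻¹ ^ 4 * (1 + (y⁻¹ * x) ^ 2)⁻¹ = Real.pi / y ^ 3 := by
    rw [integral_const_mul, Measure.integral_comp_mul_left (fun x : ℝ => (1 + x ^ 2)⁻¹),
      integral_univ_inv_one_add_sq, inv_inv, abs_of_pos hy, smul_eq_mul]
    field_simp
  rw [← hI, ofReal_integral_eq_lintegral_ofReal hi (by filter_upwards with x; positivity)]
  refine lintegral_mono fun x => ENNReal.ofReal_le_ofReal ?_
  have h1 : y⁻¹ ^ 4 * (1 + (y⁻¹ * x) ^ 2)⁻¹ = 1 / (y ^ 2 * (x ^ 2 + y ^ 2)) := by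
    field_simp
    ring
  rw [h1]
  apply one_div_le_one_div_of_le (by positivity)
  nlinarith [sq_nonneg x, sq_nonneg y, mul_nonneg (sq_nonneg x) (sq_nonneg y)]

/-- After `c⁻⁴` is extracted, unfolding bounds the part of each `c ≥ 1` by `c⁻⁴(2c + 1)π/y³`, which
is summable in `c`. The summand `1` represents `c = 0`, where `e = ±1`. -/
theorem exists_lintegral_quarticSum_le : ∃ C : ℝ, 0 < C ∧ ∀ y : ℝ, 0 < y → y ≤ 1 →
    ∫⁻ x in Icc (-1 / 2 : ℝ) (3 / 2), (1 + quarticSum y x) ≤ ENNReal.ofReal (C / y ^ 3) := by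
  have hsum : Summable fun c : ℕ => 1 / ((c : ℝ) + 1) ^ 2 := by
    have := (summable_nat_add_iff 1).mpr (Real.summable_one_div_nat_pow.mpr one_lt_two)
    simpa using this
  set Z := ∑' c : ℕ, 1 / ((c : ℝ) + 1) ^ 2 with hZ
  have hZ0 : 0 ≤ Z := tsum_nonneg fun c => by positivity
  refine ⟨2 + 3 * Real.pi * Z, by positivity, fun y hy hy1 => ?_⟩
  set g : ℝ → ENNReal := fun x => ENNReal.ofReal (1 / (x ^ 2 + y ^ 2) ^ 2) with hg
  have hgm : Measurable g := by rw [hg]; fun_prop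
  have hterm : ∀ c : ℕ, ∀ x : ℝ, ∑' e : ℤ, ENNReal.ofReal
      (1 / ((((c : ℝ) + 1) * x + e) ^ 2 + (((c : ℝ) + 1) * y) ^ 2) ^ 2) =
      ENNReal.ofReal (1 / ((c : ℝ) + 1) ^ 4) * ∑' e : ℤ, g (x + e / (c + 1 : ℕ)) := by
    intro c x
    rw [← ENNReal.tsum_mul_left]
    refine tsum_congr fun e => ?_
    rw [hg, ← ENNReal.ofReal_mul (by positivity)]
    congr 1
    have h1 : ((c : ℝ) + 1) * x + e = ((c : ℝ) + 1) * (x + e / ((c + 1 : ℕ) : ℝ)) := by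
      push_cast; field_simp
    rw [h1, mul_pow, mul_pow, ← mul_add, mul_pow, ← pow_mul, one_div_mul_one_div]
  have hc : ∀ c : ℕ, ∫⁻ x in Icc (-1 / 2 : ℝ) (3 / 2), ∑' e : ℤ, ENNReal.ofReal
      (1 / ((((c : ℝ) + 1) * x + e) ^ 2 + (((c : ℝ) + 1) * y) ^ 2) ^ 2) ≤
      ENNReal.ofReal (3 * Real.pi / y ^ 3 * (1 / ((c : ℝ) + 1) ^ 2)) := by
    intro c
    simp only [hterm]
    rw [lintegral_const_mul]
    · refine (mul_le_mul_right ((lintegral_tsum_shift_le hgm _ _ (by norm_num) _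
        (Nat.succ_pos c)).trans (mul_le_mul_right (lintegral_inv_sq_add_sq_sq_le hy) _)) _).trans ?_
      rw [← ENNReal.ofReal_mul (by positivity), ← ENNReal.ofReal_mul (by positivity)]
      apply ENNReal.ofReal_le_ofReal
      push_cast
      have h1 : (3 / 2 - -1 / 2) * ((c : ℝ) + 1) + 1 ≤ 3 * ((c : ℝ) + 1) ^ 2 := by
        have : (0 : ℝ) ≤ c := by positivity
        nlinarith
      calc 1 / ((c : ℝ) + 1) ^ 4 * (((3 / 2 - -1 / 2) * ((c : ℝ) + 1) + 1) * (Real.pi / y ^ 3))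
          ≤ 1 / ((c : ℝ) + 1) ^ 4 * ((3 * ((c : ℝ) + 1) ^ 2) * (Real.pi / y ^ 3)) := by
            gcongr
        _ = 3 * Real.pi / y ^ 3 * (1 / ((c : ℝ) + 1) ^ 2) := by
            field_simp
    · exact Measurable.tsum fun e => hgm.comp (measurable_id.add_const _)
  rw [lintegral_add_left measurable_const]
  unfold quarticSum
  rw [lintegral_tsum fun c => (Measurable.tsum fun e => by fun_prop).aemeasurable]
  refine (add_le_add le_rfl (ENNReal.tsum_le_tsum hc)).trans ?_
  rw [← ENNReal.ofReal_tsum_of_nonneg (fun c => by positivity) (hsum.mul_left _), tsum_mul_left,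
    ← hZ]
  simp only [lintegral_const, MeasurableSet.univ, Measure.restrict_apply, univ_inter,
    Real.volume_Icc, one_mul]
  rw [← ENNReal.ofReal_add (by norm_num) (by positivity)]
  apply ENNReal.ofReal_le_ofReal
  have : 2 ≤ 2 / y ^ 3 := by
    rw [le_div_iff₀ (by positivity)]
    have := pow_le_one₀ (n := 3) hy.le hy1
    linarith
  calc (3 / 2 - -1 / 2 : ℝ) + 3 * Real.pi / y ^ 3 * Z ≤ 2 / y ^ 3 + 3 * Real.pi / y ^ 3 * Z := by
        linarith
    _ = (2 + 3 * Real.pi * Z) / y ^ 3 := by ring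

/-! ### The theta product away from the integers. -/

theorem exists_uniform_theta_bound {x y : ℝ} (hy : 0 < y) (hy2 : y ≤ 1 / 2)
    (hx : ∀ m : ℤ, y ≤ |x - m|) :
    ∃ B : ℝ, 0 ≤ B ∧ (∀ u : ℝ, ‖jacobiTheta₂ u (x + y * Complex.I)‖ ≤ B) ∧
      B ^ 4 * y ^ 2 ≤ 49 / 50 ∧ ENNReal.ofReal (B ^ 8) ≤ 4 * (1 + quarticSum y x) := by
  have him : 0 < (x + y * Complex.I : ℂ).im := by simpa using hy
  obtain ⟨c, e, hce, h⟩ := exists_coprime_norm_jacobiTheta₂_le ⟨x + y * Complex.I, him⟩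
  set N : ℝ := (c * x + e) ^ 2 + (c * y) ^ 2 with hN
  have hNe : Complex.normSq (c * (x + y * Complex.I) + e) = N := by
    have : (c * (x + y * Complex.I) + e : ℂ) = ((c * x + e : ℝ) : ℂ) + ((c * y : ℝ) : ℂ) * Complex.I := by
      push_cast; ring
    rw [this, Complex.normSq_add_mul_I]
  have h' : ∀ u : ℝ, ‖jacobiTheta₂ u (x + y * Complex.I)‖ ^ 4 * N ≤ (13 / 11) ^ 4 := by
    intro u
    rw [← hNe]
    exact h u
  -- `c = 0` gives `N = 1`; `|c| = 1` gives one `y²` from the distance to the integers and one from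
  -- the imaginary part; `|c| ≥ 2` gives `4y²`.
  have hN2 : 2 * y ^ 2 ≤ N := by
    rcases lt_trichotomy (|c|) 1 with h1 | h1 | h1
    · have hc : c = 0 := Int.abs_lt_one_iff.mp h1
      subst hc
      have he : IsUnit e := isCoprime_zero_left.mp hce
      have : (e : ℝ) ^ 2 = 1 := by
        rcases Int.isUnit_iff.mp he with rfl | rfl <;> norm_num
      rw [hN]
      simp only [Int.cast_zero, zero_mul, zero_add, this]
      nlinarith
    · have key : y ^ 2 ≤ (c * x + e) ^ 2 := by
        rcases (abs_eq (by norm_num : (0 : ℤ) ≤ 1)).mp h1 with rfl | rfl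
        · have := hx (-e)
          push_cast at this ⊢
          rw [one_mul, ← sq_abs (x + e)]
          rw [sub_neg_eq_add] at this
          gcongr
        · have := hx e
          push_cast
          rw [← sq_abs (-1 * x + e), show (-1 * x + e : ℝ) = -(x - e) by ring, abs_neg]
          gcongr
      have : (c : ℝ) ^ 2 = 1 := by
        rw [← sq_abs]
        have : |(c : ℝ)| = 1 := by exact_mod_cast h1
        rw [this, one_pow]
      rw [hN, mul_pow, this]
      linarith
    · have : (2 : ℝ) ^ 2 ≤ (c : ℝ) ^ 2 := by
        rw [← sq_abs (c : ℝ)]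
        have : (2 : ℝ) ≤ |(c : ℝ)| := by exact_mod_cast h1
        gcongr
      rw [hN, mul_pow]
      nlinarith [sq_nonneg (c * x + e : ℝ), sq_nonneg y]
  have hN0 : 0 < N := lt_of_lt_of_le (by positivity) hN2
  have hB4 : (√√((13 / 11) ^ 4 / N)) ^ 4 = (13 / 11) ^ 4 / N := by
    rw [show ∀ z : ℝ, z ^ 4 = (z ^ 2) ^ 2 by intro z; ring, Real.sq_sqrt (Real.sqrt_nonneg _),
      Real.sq_sqrt (by positivity)]
  refine ⟨√√((13 / 11) ^ 4 / N), Real.sqrt_nonneg _, fun u => ?_, ?_, ?_⟩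
  · refine le_of_pow_le_pow_left₀ (n := 4) (by norm_num) (Real.sqrt_nonneg _) ?_
    rw [hB4, le_div_iff₀ hN0]
    exact h' u
  -- `(13/11)⁴/2 < 49/50 < 1` is the source of the exponential gain in `d`.
  · rw [hB4, div_mul_eq_mul_div, div_le_iff₀ hN0]
    nlinarith [sq_nonneg y]
  · have hB8 : (√√((13 / 11) ^ 4 / N)) ^ 8 = (13 / 11) ^ 8 / N ^ 2 := by
      rw [show ∀ z : ℝ, z ^ 8 = (z ^ 4) ^ 2 by intro z; ring, hB4]
      field_simp
    have h4 : (13 / 11 : ℝ) ^ 8 / N ^ 2 ≤ 4 * (1 / N ^ 2) := by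
      rw [mul_one_div]
      gcongr
      norm_num
    rw [hB8]
    refine (ENNReal.ofReal_le_ofReal h4).trans ?_
    rw [ENNReal.ofReal_mul (by norm_num)]
    have : ENNReal.ofReal 4 = 4 := by simp
    rw [this]
    gcongr
    -- `1/N²` is one term of the right side: the summand `1` if `c = 0`, and otherwise a term of
    -- `quarticSum` after `(c, e)` is replaced by `(-c, -e)` if needed.
    rcases eq_or_ne c 0 with hc | hc
    · have he : IsUnit e := isCoprime_zero_left.mp (hc ▸ hce)
      have : (e : ℝ) ^ 2 = 1 := by
        rcases Int.isUnit_iff.mp he with rfl | rfl <;> norm_num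
      rw [hN, hc]
      simp only [Int.cast_zero, zero_mul, zero_add, this]
      simp
    · refine le_trans ?_ (le_add_self)
      obtain ⟨k, hk⟩ : ∃ k : ℕ, c.natAbs = k + 1 :=
        Nat.exists_eq_succ_of_ne_zero (Int.natAbs_ne_zero.mpr hc)
      obtain ⟨e', he'⟩ : ∃ e' : ℤ, N = (((k : ℝ) + 1) * x + e') ^ 2 + (((k : ℝ) + 1) * y) ^ 2 := by
        rcases Int.natAbs_eq c with h1 | h1
        · refine ⟨e, ?_⟩
          rw [hN, h1, hk]; push_cast; ring
        · refine ⟨-e, ?_⟩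
          rw [hN, h1, hk]; push_cast; ring
      rw [he']
      exact (ENNReal.le_tsum e').trans
        (ENNReal.le_tsum (f := fun k : ℕ => ∑' e : ℤ, ENNReal.ofReal
          (1 / ((((k : ℝ) + 1) * x + e) ^ 2 + (((k : ℝ) + 1) * y) ^ 2) ^ 2)) k)

/-- The modulus of the theta product, normalised by its value at the saddle point. -/
noncomputable def thetaProd {d : ℕ} (ξ : Fin d → ℝ) (y x : ℝ) : ℝ :=
  √y ^ d * ∏ j, ‖jacobiTheta₂ (ξ j) (x + y * Complex.I)‖

theorem thetaProd_nonneg {d : ℕ} (ξ : Fin d → ℝ) (y x : ℝ) : 0 ≤ thetaProd ξ y x := by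
  unfold thetaProd; positivity

theorem continuous_jacobiTheta₂_line (u : ℂ) {y : ℝ} (hy : 0 < y) :
    Continuous fun x : ℝ => jacobiTheta₂ u (x + y * Complex.I) := by
  refine continuous_iff_continuousAt.mpr fun x => ?_
  have h1 := (differentiableAt_jacobiTheta₂_snd u (τ := x + y * Complex.I)
    (by simpa using hy)).continuousAt
  exact ContinuousAt.comp (f := fun x : ℝ => (x + y * Complex.I : ℂ)) h1
    (by fun_prop)

theorem continuous_thetaProd {d : ℕ} (ξ : Fin d → ℝ) {y : ℝ} (hy : 0 < y) :
    Continuous (thetaProd ξ y) := by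
  unfold thetaProd
  exact continuous_const.mul
    (continuous_finsetProd _ fun j _ => (continuous_jacobiTheta₂_line _ hy).norm)

/-- The part of the period `[-1/2, 3/2]` that is at distance at least `y` from the integers. -/
def farSet (y : ℝ) : Set ℝ :=
  Icc (-1 / 2) (3 / 2) \ (Ioo (-y) y ∪ Ioo (1 - y) (1 + y))

theorem measurableSet_farSet (y : ℝ) : MeasurableSet (farSet y) :=
  measurableSet_Icc.diff (measurableSet_Ioo.union measurableSet_Ioo)

theorem le_abs_sub_of_mem_farSet {x y : ℝ} (hy2 : y ≤ 1 / 2) (hx : x ∈ farSet y) (m : ℤ) :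
    y ≤ |x - m| := by
  obtain ⟨⟨h1, h2⟩, h3⟩ := hx
  simp only [mem_union, mem_Ioo, not_or, not_and_or, not_lt] at h3
  obtain ⟨h3, h4⟩ := h3
  rw [le_abs]
  rcases lt_trichotomy m 0 with h | h | h
  · left
    have : (m : ℝ) ≤ -1 := by exact_mod_cast Int.le_sub_one_of_lt h
    linarith
  · subst h
    rcases h3 with h3 | h3
    · right; push_cast; linarith
    · left; push_cast; linarith
  · rcases eq_or_lt_of_le (Int.add_one_le_of_lt h) with h5 | h5
    · have : (m : ℝ) = 1 := by rw [← h5]; simp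
      rw [this]
      rcases h4 with h4 | h4
      · right; linarith
      · left; linarith
    · right
      have : (2 : ℝ) ≤ m := by exact_mod_cast h5
      linarith

/-- Here `d - 8` factors are bounded by `ρ` and the other eight by `y⁴B⁸`, with `B⁸` of integral
`O(y⁻³)`. The resulting factor `y` is essential: the main term has size `y/√d`, so a pointwise bound
`ρ^d` would not suffice. -/
theorem exists_setIntegral_farSet_le : ∃ C ρ : ℝ, 0 < C ∧ 0 < ρ ∧ ρ < 1 ∧
    ∀ (d : ℕ) (ξ : Fin d → ℝ) (y : ℝ), 8 ≤ d → 0 < y → y ≤ 1 / 2 →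
      ∫ x in farSet y, thetaProd ξ y x ≤ C * ρ ^ d * y := by
  obtain ⟨C, hC, hint⟩ := exists_lintegral_quarticSum_le
  set ρ : ℝ := √√(49 / 50) with hρ
  have hρ4 : ρ ^ 4 = 49 / 50 := by
    rw [hρ, show ∀ z : ℝ, z ^ 4 = (z ^ 2) ^ 2 by intro z; ring, Real.sq_sqrt (Real.sqrt_nonneg _),
      Real.sq_sqrt (by norm_num)]
  have hρ0 : 0 < ρ := Real.sqrt_pos.mpr (Real.sqrt_pos.mpr (by norm_num))
  have hρ1 : ρ < 1 := by
    refine lt_of_pow_lt_pow_left₀ 4 zero_le_one ?_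
    rw [hρ4]; norm_num
  refine ⟨4 * C / ρ ^ 8, ρ, by positivity, hρ0, hρ1, fun d ξ y hd hy hy2 => ?_⟩
  have hpt : ∀ x ∈ farSet y, ENNReal.ofReal (thetaProd ξ y x) ≤
      ENNReal.ofReal (4 * ρ ^ (d - 8) * y ^ 4) * (1 + quarticSum y x) := by
    intro x hx
    obtain ⟨B, hB0, hB, hB4, hB8⟩ :=
      exists_uniform_theta_bound hy hy2 (le_abs_sub_of_mem_farSet hy2 hx)
    have hsB : √y * B ≤ ρ := by
      refine le_of_pow_le_pow_left₀ (n := 4) (by norm_num) hρ0.le ?_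
      rw [hρ4, mul_pow, show √y ^ 4 = (√y ^ 2) ^ 2 by ring, Real.sq_sqrt hy.le]
      linarith
    have h1 : thetaProd ξ y x ≤ ρ ^ (d - 8) * y ^ 4 * B ^ 8 := by
      calc thetaProd ξ y x ≤ √y ^ d * ∏ _j : Fin d, B := by
            unfold thetaProd
            gcongr with j
            exact hB _
        _ = (√y * B) ^ (d - 8) * (√y * B) ^ 8 := by
            rw [← pow_add, Nat.sub_add_cancel hd, mul_pow]; simp
        _ ≤ ρ ^ (d - 8) * (√y * B) ^ 8 := by
            gcongr
        _ = ρ ^ (d - 8) * y ^ 4 * B ^ 8 := by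
            rw [mul_pow, show √y ^ 8 = (√y ^ 2) ^ 4 by ring, Real.sq_sqrt hy.le]; ring
    refine (ENNReal.ofReal_le_ofReal h1).trans ?_
    rw [ENNReal.ofReal_mul (by positivity)]
    refine (mul_le_mul_right hB8 _).trans (le_of_eq ?_)
    rw [← mul_assoc, show (4 * ρ ^ (d - 8) * y ^ 4) = (ρ ^ (d - 8) * y ^ 4) * 4 by ring,
      ENNReal.ofReal_mul (p := ρ ^ (d - 8) * y ^ 4) (by positivity)]
    simp
  have h2 : ∫⁻ x in farSet y, ENNReal.ofReal (thetaProd ξ y x) ≤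
      ENNReal.ofReal (4 * C / ρ ^ 8 * ρ ^ d * y) := by
    calc ∫⁻ x in farSet y, ENNReal.ofReal (thetaProd ξ y x)
        ≤ ∫⁻ x in farSet y, ENNReal.ofReal (4 * ρ ^ (d - 8) * y ^ 4) * (1 + quarticSum y x) :=
          setLIntegral_mono' (measurableSet_farSet y) hpt
      _ ≤ ∫⁻ x in Icc (-1 / 2) (3 / 2),
            ENNReal.ofReal (4 * ρ ^ (d - 8) * y ^ 4) * (1 + quarticSum y x) :=
          lintegral_mono_set sdiff_subset
      _ = ENNReal.ofReal (4 * ρ ^ (d - 8) * y ^ 4) *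
            ∫⁻ x in Icc (-1 / 2) (3 / 2), (1 + quarticSum y x) :=
          lintegral_const_mul _ (measurable_const.add (measurable_quarticSum y))
      _ ≤ ENNReal.ofReal (4 * ρ ^ (d - 8) * y ^ 4) * ENNReal.ofReal (C / y ^ 3) := by
          gcongr
          exact hint y hy (by linarith)
      _ = ENNReal.ofReal (4 * C / ρ ^ 8 * ρ ^ d * y) := by
          rw [← ENNReal.ofReal_mul (by positivity)]
          congr 1
          have : ρ ^ d = ρ ^ (d - 8) * ρ ^ 8 := by rw [← pow_add, Nat.sub_add_cancel hd]
          rw [this]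
          field_simp
  rw [integral_eq_lintegral_of_nonneg_ae (Filter.Eventually.of_forall fun x => thetaProd_nonneg ξ y x)
    (continuous_thetaProd ξ hy).aestronglyMeasurable]
  exact ENNReal.toReal_le_of_le_ofReal (by positivity) h2

/-! ### Upper bounds on the arcs around 0 and 1. -/

theorem norm_jacobiTheta_sub_one_le_four_mul {t : ℝ} (ht : 1 ≤ t) {τ : ℂ} (hτ : t ≤ Real.pi * τ.im) :
    ‖jacobiTheta τ - 1‖ ≤ 4 / t := by
  have hpos : 0 < τ.im := by
    by_contra h
    have := mul_nonpos_of_nonneg_of_nonpos Real.pi_pos.le (not_lt.mp h)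
    linarith
  have h1 := norm_jacobiTheta_sub_one_le hpos
  have h2 : Real.exp (-Real.pi * τ.im) ≤ 1 / (1 + t) := by
    rw [neg_mul, Real.exp_neg, ← one_div]
    apply one_div_le_one_div_of_le (by linarith)
    linarith [Real.add_one_le_exp (Real.pi * τ.im)]
  have h3 : (1 : ℝ) / (1 + t) ≤ 1 / 2 := one_div_le_one_div_of_le (by norm_num) (by linarith)
  refine h1.trans ?_
  calc 2 / (1 - Real.exp (-Real.pi * τ.im)) * Real.exp (-Real.pi * τ.im)
      ≤ 2 / (1 / 2) * (1 / (1 + t)) := by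
        gcongr
        linarith
    _ ≤ 2 / (1 / 2) * (1 / t) := by
        gcongr
        linarith
    _ = 4 / t := by ring

theorem tsum_gaussian_shift_le_exp (a : ℝ) {Y : ℝ} (hY : 8 ≤ Real.pi * Y) :
    ∑' n : ℤ, Real.exp (-Real.pi * (n + a) ^ 2 * Y) ≤
      Real.exp (-Real.pi * ‖(a : UnitAddCircle)‖ ^ 2 * Y / 2) * (1 + 32 / (Real.pi * Y)) := by
  have hY0 : 0 < Y := by
    by_contra h
    have := mul_nonpos_of_nonneg_of_nonpos Real.pi_pos.le (not_lt.mp h)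
    linarith
  set δ := a - round a with hδ
  have hδ2 : |δ| ≤ 1 / 2 := abs_sub_round a
  have hshift : ∑' n : ℤ, Real.exp (-Real.pi * (n + a) ^ 2 * Y) =
      ∑' n : ℤ, Real.exp (-Real.pi * (n + δ) ^ 2 * Y) := by
    rw [← (Equiv.addRight (round a)).tsum_eq (fun n : ℤ => Real.exp (-Real.pi * (n + δ) ^ 2 * Y))]
    refine tsum_congr fun n => ?_
    simp only [Equiv.coe_addRight, hδ]
    push_cast
    ring_nf
  have hY8 : 0 < Y / 8 := by positivity
  have hsum : ∀ b : ℝ, ∀ Z : ℝ, 0 < Z →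
      Summable fun n : ℤ => Real.exp (-Real.pi * (n + b) ^ 2 * Z) := by
    intro b Z hZ
    simpa using (norm_thetaChar_le_tsum b 0 (τ := Complex.I * Z) (by simpa using hZ)).1
  have hterm : ∀ n : ℤ, Real.exp (-Real.pi * (n + δ) ^ 2 * Y) ≤
      Real.exp (-Real.pi * δ ^ 2 * Y / 2) * Real.exp (-Real.pi * (n + (0 : ℝ)) ^ 2 * (Y / 8)) := by
    intro n
    rw [← Real.exp_add]
    apply Real.exp_le_exp.mpr
    -- Half of the decay in `δ` is kept, leaving an unshifted Gaussian sum with parameter `Y/8`. The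
    -- inequality is sharp at `n = ±1`, `δ = ∓1/2`.
    have key : δ ^ 2 / 2 + (n : ℝ) ^ 2 / 8 ≤ (n + δ) ^ 2 := by
      obtain ⟨h1, h2⟩ := abs_le.mp hδ2
      rcases lt_trichotomy n 0 with h | h | h
      · have : (n : ℝ) ≤ -1 := by exact_mod_cast Int.le_sub_one_of_lt h
        nlinarith
      · subst h
        push_cast
        nlinarith [sq_nonneg δ]
      · have : (1 : ℝ) ≤ n := by exact_mod_cast h
        nlinarith
    have := mul_le_mul_of_nonneg_left key (mul_pos Real.pi_pos hY0).le
    rw [add_zero]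
    linarith
  rw [hshift, UnitAddCircle.norm_eq, sq_abs]
  refine ((hsum δ Y hY0).tsum_le_tsum hterm ((hsum 0 _ hY8).mul_left _)).trans ?_
  rw [tsum_mul_left]
  gcongr
  refine (tsum_gaussian_shift_le 0 hY8).trans ?_
  have h1 := norm_jacobiTheta_sub_one_le_four_mul (t := Real.pi * Y / 8) (by linarith)
    (τ := Complex.I * ((Y / 8 : ℝ) : ℂ)) (by simp; linarith)
  have h2 : ‖jacobiTheta (Complex.I * ((Y / 8 : ℝ) : ℂ))‖ ≤
      1 + ‖jacobiTheta (Complex.I * ((Y / 8 : ℝ) : ℂ)) - 1‖ := by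
    simpa using norm_add_le 1 (jacobiTheta (Complex.I * ((Y / 8 : ℝ) : ℂ)) - 1)
  have h3 : 4 / (Real.pi * Y / 8) = 32 / (Real.pi * Y) := by
    field_simp; norm_num
  linarith

theorem exp_half_le_one_add {t : ℝ} (h0 : 0 ≤ t) (h1 : t ≤ 1) : Real.exp (t / 2) ≤ 1 + t := by
  have h2 := Real.add_one_le_exp (-(t / 2))
  rw [Real.exp_neg] at h2
  have h3 := Real.exp_pos (t / 2)
  have h4 : (-(t / 2) + 1) * Real.exp (t / 2) ≤ 1 := by
    have := mul_le_mul_of_nonneg_right h2 h3.le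
    rwa [inv_mul_cancel₀ h3.ne'] at this
  nlinarith

/-- After inversion `Im(-1/τ) ≥ 1/(2y)` is large, so the dual Gaussian sum gives the decay in `u`.
The factor `y/|τ| = (1 + (x/y)²)^{-1/2}` gives the decay in `x`. Later `η = d⁻²`. -/
theorem sqrt_mul_norm_jacobiTheta₂_le (u : ℝ) {x y η : ℝ} (hy : 0 < y) (hx : |x| ≤ y)
    (hη : 24 * y ≤ η) (hη1 : η ≤ 1) :
    √y * ‖jacobiTheta₂ u (x + y * Complex.I)‖ ≤ Real.exp (-(x / y) ^ 2 / 8) *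
      Real.exp (-Real.pi * ‖(u : UnitAddCircle)‖ ^ 2 / (4 * y)) * (1 + η) := by
  set τ : ℂ := x + y * Complex.I with hτ
  have him : τ.im = y := by simp [hτ]
  have hne : τ ≠ 0 := by
    intro h
    rw [h] at him
    exact hy.ne him
  have hx2 : x ^ 2 ≤ y ^ 2 := sq_le_sq' (by linarith [(abs_le.mp hx).1]) (abs_le.mp hx).2
  have hnsq : ‖τ‖ ^ 2 = x ^ 2 + y ^ 2 := by
    rw [← Complex.normSq_eq_norm_sq, hτ, Complex.normSq_add_mul_I]
  have hnpos : 0 < ‖τ‖ := norm_pos_iff.mpr hne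
  set Y : ℝ := (-1 / τ).im with hYdef
  have hY : Y = y / (x ^ 2 + y ^ 2) := by
    rw [hYdef, ← hnsq, ← Complex.normSq_eq_norm_sq, Complex.div_im, him]
    simp
    ring
  have hY0 : 0 < Y := by rw [hY]; positivity
  have hYy : 1 / (2 * y) ≤ Y := by
    rw [hY, div_le_div_iff₀ (by positivity) (by positivity)]
    nlinarith
  have hpi := Real.pi_gt_d2
  have hη0 : 0 < η := by linarith
  have hYpi : 1 / y * (3 / 2) ≤ Real.pi * Y := by
    calc 1 / y * (3 / 2) = 3 * (1 / (2 * y)) := by field_simp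
      _ ≤ Real.pi * Y := by gcongr; linarith
  have hyinv : 24 / η ≤ 1 / y := by
    rw [div_le_div_iff₀ hη0 hy]; linarith
  have h24 : 24 ≤ 24 / η := by rw [le_div_iff₀ hη0]; linarith
  have hsum := (norm_thetaChar_le_tsum (-u) 0 (τ := -1 / τ) hY0).2
  have hG := hsum.trans (tsum_gaussian_shift_le_exp (-u) (Y := Y) (by linarith))
  have hnorm : ‖((-u : ℝ) : UnitAddCircle)‖ = ‖(u : UnitAddCircle)‖ := by
    rw [AddCircle.coe_neg, norm_neg]
  rw [hnorm] at hG
  have hS : ‖jacobiTheta₂ u τ‖ ^ 2 * ‖τ‖ = ‖thetaChar (-u) 0 (-1 / τ)‖ ^ 2 := by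
    have := norm_thetaChar_inv 0 u hne
    rwa [thetaChar_zero_left] at this
  have hG2 : ‖thetaChar (-u) 0 (-1 / τ)‖ ≤
      Real.exp (-Real.pi * ‖(u : UnitAddCircle)‖ ^ 2 / (4 * y)) * (1 + η) := by
    refine hG.trans ?_
    have e1 : -Real.pi * ‖(u : UnitAddCircle)‖ ^ 2 * Y / 2 ≤
        -Real.pi * ‖(u : UnitAddCircle)‖ ^ 2 / (4 * y) := by
      have := mul_le_mul_of_nonneg_left hYy
        (by positivity : 0 ≤ Real.pi * ‖(u : UnitAddCircle)‖ ^ 2 / 2)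
      calc -Real.pi * ‖(u : UnitAddCircle)‖ ^ 2 * Y / 2
          = -(Real.pi * ‖(u : UnitAddCircle)‖ ^ 2 / 2 * Y) := by ring
        _ ≤ -(Real.pi * ‖(u : UnitAddCircle)‖ ^ 2 / 2 * (1 / (2 * y))) := by linarith
        _ = _ := by field_simp; ring
    have e2 : 32 / (Real.pi * Y) ≤ η := by
      rw [div_le_iff₀ (by positivity)]
      have : η * (24 / η) = 24 := by field_simp
      have := mul_le_mul_of_nonneg_left hyinv hη0.le
      have := mul_le_mul_of_nonneg_left hYpi hη0.le
      linarith
    gcongr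
  have hratio : y / ‖τ‖ ≤ Real.exp (-(x / y) ^ 2 / 8) ^ 2 := by
    have ht : (x / y) ^ 2 ≤ 1 := by
      rw [div_pow, div_le_one (by positivity)]; exact hx2
    have h1 := exp_half_le_one_add (sq_nonneg (x / y)) ht
    have h2 : Real.exp ((x / y) ^ 2 / 2) * y ^ 2 ≤ ‖τ‖ ^ 2 := by
      rw [hnsq]
      calc _ ≤ (1 + (x / y) ^ 2) * y ^ 2 := by gcongr
        _ = _ := by field_simp; ring
    have h3 : Real.exp ((x / y) ^ 2 / 4) * y ≤ ‖τ‖ := by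
      refine le_of_sq_le_sq ?_ hnpos.le
      rw [mul_pow, ← Real.exp_nat_mul]
      rwa [show ((2 : ℕ) : ℝ) * ((x / y) ^ 2 / 4) = (x / y) ^ 2 / 2 by push_cast; ring]
    rw [div_le_iff₀ hnpos, ← Real.exp_nat_mul]
    have h4 : Real.exp ((2 : ℕ) * (-(x / y) ^ 2 / 8)) * Real.exp ((x / y) ^ 2 / 4) = 1 := by
      rw [← Real.exp_add, ← Real.exp_zero]
      congr 1
      push_cast; ring
    have := mul_le_mul_of_nonneg_left h3 (Real.exp_pos ((2 : ℕ) * (-(x / y) ^ 2 / 8))).le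
    rwa [← mul_assoc, h4, one_mul] at this
  refine le_of_sq_le_sq ?_ (by positivity)
  rw [mul_pow, Real.sq_sqrt hy.le, mul_assoc (Real.exp (-(x / y) ^ 2 / 8)), mul_pow]
  calc y * ‖jacobiTheta₂ u τ‖ ^ 2 = y / ‖τ‖ * ‖thetaChar (-u) 0 (-1 / τ)‖ ^ 2 := by
        rw [← hS]; field_simp
    _ ≤ _ := by gcongr

/-- The accumulated cost of relative errors `d⁻²` in at most `d` factors. -/
theorem one_add_inv_sq_pow_le {d m : ℕ} (hd : 1 ≤ d) (hm : m ≤ d) :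
    (1 + 1 / (d : ℝ) ^ 2) ^ m ≤ 3 := by
  have hd' : (1 : ℝ) ≤ d := by exact_mod_cast hd
  have hm' : (m : ℝ) ≤ d := by exact_mod_cast hm
  calc (1 + 1 / (d : ℝ) ^ 2) ^ m ≤ Real.exp (1 / (d : ℝ) ^ 2) ^ m := by
        gcongr
        linarith [Real.add_one_le_exp (1 / (d : ℝ) ^ 2)]
    _ = Real.exp (m * (1 / (d : ℝ) ^ 2)) := (Real.exp_nat_mul _ _).symm
    _ ≤ Real.exp 1 := by
        apply Real.exp_le_exp.mpr
        rw [mul_one_div, div_le_one (by positivity)]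
        nlinarith
    _ ≤ 3 := by linarith [Real.exp_one_lt_d9]

theorem intervalIntegral_gaussian_le {y b : ℝ} (hy : 0 < y) (hb : 0 < b) :
    ∫ x in -y..y, Real.exp (-(b * (x / y) ^ 2)) ≤ y * √(Real.pi / b) := by
  have hb' : 0 < b / y ^ 2 := by positivity
  have h1 : ∀ x : ℝ, Real.exp (-(b * (x / y) ^ 2)) = Real.exp (-(b / y ^ 2) * x ^ 2) := by
    intro x; congr 1; field_simp
  simp only [h1]
  rw [intervalIntegral.integral_of_le (by linarith)]
  refine (setIntegral_le_integral (integrable_exp_neg_mul_sq hb')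
    (Filter.Eventually.of_forall fun x => (Real.exp_pos _).le)).trans (le_of_eq ?_)
  rw [integral_gaussian, show Real.pi / (b / y ^ 2) = y ^ 2 * (Real.pi / b) by field_simp,
    Real.sqrt_mul (sq_nonneg y), Real.sqrt_sq hy.le]

theorem integral_thetaProd_near_zero_le {d : ℕ} (hd : 1 ≤ d) (ξ : Fin d → ℝ) {y : ℝ} (hy : 0 < y)
    (hyd : 24 * y ≤ 1 / (d : ℝ) ^ 2) :
    ∫ x in -y..y, thetaProd ξ y x ≤ 18 * y / √d *
      Real.exp (-Real.pi * (∑ j, ‖(ξ j : UnitAddCircle)‖ ^ 2) / (4 * y)) := by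
  have hd' : (1 : ℝ) ≤ d := by exact_mod_cast hd
  have hη1 : 1 / (d : ℝ) ^ 2 ≤ 1 := by
    rw [div_le_one (by positivity)]; nlinarith
  set E := Real.exp (-Real.pi * (∑ j, ‖(ξ j : UnitAddCircle)‖ ^ 2) / (4 * y)) with hE
  have hpt : ∀ x ∈ Icc (-y) y, thetaProd ξ y x ≤
      3 * E * Real.exp (-(d / 8 * (x / y) ^ 2)) := by
    intro x hx
    have hx' : |x| ≤ y := abs_le.mpr hx
    calc thetaProd ξ y x = ∏ j, √y * ‖jacobiTheta₂ (ξ j) (x + y * Complex.I)‖ := by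
          rw [thetaProd, Finset.prod_mul_distrib]; simp
      _ ≤ ∏ j, Real.exp (-(x / y) ^ 2 / 8) *
            Real.exp (-Real.pi * ‖(ξ j : UnitAddCircle)‖ ^ 2 / (4 * y)) *
            (1 + 1 / (d : ℝ) ^ 2) := by
          refine Finset.prod_le_prod (fun j _ => by positivity) fun j _ => ?_
          exact sqrt_mul_norm_jacobiTheta₂_le (ξ j) hy hx' hyd hη1
      _ = Real.exp (-(x / y) ^ 2 / 8) ^ d * E * (1 + 1 / (d : ℝ) ^ 2) ^ d := by
          rw [Finset.prod_mul_distrib, Finset.prod_mul_distrib, hE, Finset.mul_sum,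
            Finset.sum_div, Real.exp_sum]
          simp
      _ ≤ Real.exp (-(x / y) ^ 2 / 8) ^ d * E * 3 := by
          gcongr
          exact one_add_inv_sq_pow_le hd le_rfl
      _ = 3 * E * Real.exp (-(d / 8 * (x / y) ^ 2)) := by
          rw [← Real.exp_nat_mul, show (d : ℝ) * (-(x / y) ^ 2 / 8) = -(d / 8 * (x / y) ^ 2) by ring]
          ring
  have h8 : √(Real.pi / ((d : ℝ) / 8)) ≤ 6 / √d := by
    rw [show Real.pi / ((d : ℝ) / 8) = (8 * Real.pi) / d by field_simp,
      Real.sqrt_div (by positivity)]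
    gcongr
    rw [Real.sqrt_le_left (by norm_num)]
    linarith [Real.pi_lt_d2]
  calc ∫ x in -y..y, thetaProd ξ y x
      ≤ ∫ x in -y..y, 3 * E * Real.exp (-(d / 8 * (x / y) ^ 2)) := by
        refine intervalIntegral.integral_mono_on (by linarith)
          ((continuous_thetaProd ξ hy).intervalIntegrable _ _)
          (Continuous.intervalIntegrable (by fun_prop) _ _) hpt
    _ = 3 * E * ∫ x in -y..y, Real.exp (-(d / 8 * (x / y) ^ 2)) := by
        rw [intervalIntegral.integral_const_mul]
    _ ≤ 3 * E * (y * (6 / √d)) := by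
        gcongr
        exact (intervalIntegral_gaussian_le hy (by positivity)).trans (by gcongr)
    _ = 18 * y / √d * E := by ring

/-- This moves the arc around 1 to the arc around 0 and is the origin of the point `ξ + 𝟏/2`. -/
theorem thetaProd_add_one {d : ℕ} (ξ : Fin d → ℝ) (y x : ℝ) :
    thetaProd ξ y (x + 1) = thetaProd (fun j => ξ j + 1 / 2) y x := by
  unfold thetaProd
  congr 2
  funext j
  rw [show (((x + 1 : ℝ) : ℂ) + y * Complex.I) = (x + y * Complex.I) + 1 by push_cast; ring,
    jacobiTheta₂_add_one]
  push_cast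
  rfl

theorem integral_thetaProd_near_one_le {d : ℕ} (hd : 1 ≤ d) (ξ : Fin d → ℝ) {y : ℝ} (hy : 0 < y)
    (hyd : 24 * y ≤ 1 / (d : ℝ) ^ 2) :
    ∫ x in 1 - y..1 + y, thetaProd ξ y x ≤ 18 * y / √d *
      Real.exp (-Real.pi * (∑ j, ‖((ξ j + 1 / 2 : ℝ) : UnitAddCircle)‖ ^ 2) / (4 * y)) := by
  have h := integral_thetaProd_near_zero_le hd (fun j => ξ j + 1 / 2) hy hyd
  simp only [← thetaProd_add_one] at h
  rwa [intervalIntegral.integral_comp_add_right (thetaProd ξ y), neg_add_eq_sub, add_comm y 1] at h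

/-! ### The saddle point at 0: Gaussian approximation and lower bound. -/

open Complex in
/-- The Gaussian approximation at the saddle point. -/
theorem norm_exp_log_sub_gaussian_le {s : ℝ} (hs : |s| ≤ 1) :
    ‖cexp (-(log (1 - I * s) + I * s) / 2)‖ ≤ 1 ∧
    ‖cexp (-(log (1 - I * s) + I * s) / 2) - Real.exp (-s ^ 2 / 4)‖ ≤ 16 * |s| ^ 3 := by
  have hnorm : ‖cexp (-(log (1 - I * s) + I * s) / 2)‖ ≤ 1 := by
    rw [Complex.norm_exp, ← Real.exp_zero, Real.exp_le_exp]
    have h1 : (-(log (1 - I * s) + I * s) / 2).re = -(Real.log ‖1 - I * s‖) / 2 := by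
      rw [← Complex.log_re]
      simp
    have h2 : 1 ≤ ‖1 - I * (s : ℂ)‖ := by
      have := Complex.abs_re_le_norm (1 - I * (s : ℂ))
      simpa using this
    have := Real.log_nonneg h2
    rw [h1]
    linarith
  refine ⟨hnorm, ?_⟩
  have hs0 := abs_nonneg s
  have hv1 : Real.exp (-s ^ 2 / 4) ≤ 1 := Real.exp_le_one_iff.mpr (by nlinarith [sq_nonneg s])
  have hvn : ‖(Real.exp (-s ^ 2 / 4) : ℂ)‖ = Real.exp (-s ^ 2 / 4) := by
    rw [Complex.norm_real, Real.norm_of_nonneg (Real.exp_pos _).le]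
  -- For small `s`, `log(1 - is) = -is + s²/2 + O(|s|³)`. For `|s| ≥ 1/2` both terms have norm at
  -- most 1 and `16|s|³ ≥ 2`.
  rcases le_total (|s|) (1 / 2) with h | h
  · have hz : ‖-(I * (s : ℂ))‖ = |s| := by simp
    have hlog := norm_log_sub_logTaylor_le 2 (z := -(I * (s : ℂ))) (by rw [hz]; linarith)
    rw [hz] at hlog
    have htay : logTaylor (2 + 1) (-(I * (s : ℂ))) = -(I * s) + s ^ 2 / 2 := by
      rw [logTaylor_succ, logTaylor_succ, logTaylor_succ, logTaylor_zero]
      simp only [Pi.add_apply]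
      push_cast
      linear_combination (-(s : ℂ) ^ 2 / 2) * I_sq
    rw [htay] at hlog
    set E : ℂ := -(log (1 - I * s) + I * s - s ^ 2 / 2) / 2 with hE
    have hE3 : ‖E‖ ≤ |s| ^ 3 / 3 := by
      have h1 : E = -(log (1 + -(I * (s : ℂ))) - (-(I * s) + s ^ 2 / 2)) / 2 := by
        rw [hE, ← sub_eq_add_neg]; ring
      have h2 : (1 - |s|)⁻¹ ≤ 2 := by
        rw [inv_le_comm₀ (by linarith) (by norm_num)]; linarith
      rw [h1, norm_div, norm_neg]
      have h3 : |s| ^ (2 + 1) * (1 - |s|)⁻¹ / ((2 : ℕ) + 1) ≤ |s| ^ (2 + 1) * 2 / 3 := by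
        push_cast
        norm_num
        gcongr
      have h4 : ‖(2 : ℂ)‖ = 2 := by simp
      rw [h4]
      linarith
    have hfac : cexp (-(log (1 - I * s) + I * s) / 2) =
        (Real.exp (-s ^ 2 / 4) : ℂ) * cexp E := by
      rw [Complex.ofReal_exp, ← Complex.exp_add]
      congr 1
      rw [hE]; push_cast; ring
    have h3 : |s| ^ 3 ≤ 1 := pow_le_one₀ hs0 hs
    have hexp := Complex.norm_exp_sub_one_le (x := E) (by linarith)
    calc ‖cexp (-(log (1 - I * s) + I * s) / 2) - Real.exp (-s ^ 2 / 4)‖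
        = ‖(Real.exp (-s ^ 2 / 4) : ℂ) * (cexp E - 1)‖ := by rw [hfac]; ring_nf
      _ = Real.exp (-s ^ 2 / 4) * ‖cexp E - 1‖ := by rw [norm_mul, hvn]
      _ ≤ 1 * (2 * (|s| ^ 3 / 3)) := by
          gcongr
          linarith
      _ ≤ 16 * |s| ^ 3 := by nlinarith [pow_nonneg hs0 3]
  · have h3 : (1 / 2 : ℝ) ^ 3 ≤ |s| ^ 3 := by gcongr
    refine (norm_sub_le _ _).trans ?_
    rw [hvn]
    linarith

open Complex in
/-- The theta value, with the phase at the saddle point removed and normalised. -/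
noncomputable def saddleFactor (y x : ℝ) : ℂ :=
  cexp (-(I * (x / y : ℝ)) / 2) * √y * jacobiTheta₂ 0 (x + y * I)

-- With `s = x/y` one has `-iτ = y(1 - is)`, so inversion gives `(1 - is)^{-1/2} e^{-is/2} θ(-1/τ)`,
-- whose last factor is within `η` of 1.
open Complex in
theorem norm_saddleFactor_sub_gaussian_le {x y η : ℝ} (hy : 0 < y) (hx : |x| ≤ y)
    (hη : 24 * y ≤ η) (hη1 : η ≤ 1) :
    ‖saddleFactor y x - Real.exp (-(x / y) ^ 2 / 4)‖ ≤ 16 * |x / y| ^ 3 + η := by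
  set s := x / y with hs
  have hs1 : |s| ≤ 1 := by
    rw [hs, abs_div, abs_of_pos hy, div_le_one hy]; exact hx
  have hxs : x = y * s := by rw [hs]; field_simp
  set τ : ℂ := x + y * I with hτ
  have him : τ.im = y := by simp [hτ]
  have hx2 : x ^ 2 ≤ y ^ 2 := sq_le_sq' (by linarith [(abs_le.mp hx).1]) (abs_le.mp hx).2
  have hY : (-1 / τ).im = y / (x ^ 2 + y ^ 2) := by
    rw [Complex.div_im, him, hτ, Complex.normSq_add_mul_I]
    simp
    ring
  have hYy : 1 / (2 * y) ≤ (-1 / τ).im := by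
    rw [hY, div_le_div_iff₀ (by positivity) (by positivity)]
    nlinarith
  have hIτ : -I * τ = (y : ℂ) * (1 - I * s) := by
    rw [hτ, hxs]; push_cast
    linear_combination (-(y : ℂ)) * I_sq
  have hne : (1 - I * (s : ℂ)) ≠ 0 := by
    intro h
    have := congrArg Complex.re h
    simp at this
  have hcp : (-I * τ) ^ (1 / 2 : ℂ) = √y * cexp (log (1 - I * s) / 2) := by
    have hy0 : (y : ℂ) ≠ 0 := by exact_mod_cast hy.ne'
    have h1 : (√y : ℂ) = cexp (Real.log y / 2 : ℝ) := by
      rw [← Complex.ofReal_exp]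
      congr 1
      rw [Real.exp_half, Real.exp_log hy]
    rw [hIτ, Complex.cpow_def_of_ne_zero (mul_ne_zero hy0 hne), Complex.log_ofReal_mul hy hne, h1,
      ← Complex.exp_add]
    congr 1
    push_cast; ring
  have hsy : (√y : ℂ) ≠ 0 := by exact_mod_cast (Real.sqrt_pos.mpr hy).ne'
  have hw : saddleFactor y x = cexp (-(log (1 - I * s) + I * s) / 2) * jacobiTheta (-1 / τ) := by
    rw [saddleFactor, ← hτ, ← hs, jacobiTheta₂_functional_equation, hcp, jacobiTheta_eq_jacobiTheta₂]
    have h2 : cexp (-(log (1 - I * s) + I * s) / 2) =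
        cexp (-(I * s) / 2) * (cexp (log (1 - I * s) / 2))⁻¹ := by
      rw [← Complex.exp_neg, ← Complex.exp_add]
      congr 1; ring
    rw [h2]
    simp
    field_simp
  obtain ⟨hg1, hg⟩ := norm_exp_log_sub_gaussian_le hs1
  set g := cexp (-(log (1 - I * s) + I * s) / 2) with hgdef
  have hη0 : 0 < η := by linarith
  have hϑ : ‖jacobiTheta (-1 / τ) - 1‖ ≤ η := by
    have h1 : 4 / η ≤ Real.pi * (-1 / τ).im := by
      have h2 : 24 / η ≤ 1 / y := by
        rw [div_le_div_iff₀ hη0 hy]; linarith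
      calc 4 / η ≤ 24 / η := by gcongr; norm_num
        _ ≤ 1 / y := h2
        _ ≤ 3 * (1 / (2 * y)) := by
            rw [show 3 * (1 / (2 * y)) = 1 / y * (3 / 2) by field_simp]
            have : 0 ≤ 1 / y := by positivity
            linarith
        _ ≤ Real.pi * (-1 / τ).im := by
            gcongr
            exact Real.pi_gt_three.le
    have h3 := norm_jacobiTheta_sub_one_le_four_mul (t := 4 / η)
      (by rw [le_div_iff₀ hη0]; linarith) h1
    refine h3.trans (le_of_eq ?_)
    field_simp
  calc ‖saddleFactor y x - Real.exp (-s ^ 2 / 4)‖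
      = ‖(g - Real.exp (-s ^ 2 / 4)) + g * (jacobiTheta (-1 / τ) - 1)‖ := by rw [hw]; ring_nf
    _ ≤ ‖g - Real.exp (-s ^ 2 / 4)‖ + ‖g‖ * ‖jacobiTheta (-1 / τ) - 1‖ :=
        (norm_add_le _ _).trans (by rw [norm_mul])
    _ ≤ 16 * |s| ^ 3 + 1 * η := by gcongr
    _ = _ := by ring

theorem norm_pow_sub_pow_le {w v : ℂ} {M : ℝ} (hw : ‖w‖ ≤ M) (hv : ‖v‖ ≤ M) (n : ℕ) :
    ‖w ^ n - v ^ n‖ ≤ n * ‖w - v‖ * M ^ (n - 1) := by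
  have hM : 0 ≤ M := (norm_nonneg w).trans hw
  rw [← geom_sum₂_mul w v, norm_mul]
  have h1 : ‖∑ i ∈ Finset.range n, w ^ i * v ^ (n - 1 - i)‖ ≤ n * M ^ (n - 1) := by
    refine (norm_sum_le_of_le (f := fun i => w ^ i * v ^ (n - 1 - i)) (n := fun _ => M ^ (n - 1)) _
      fun i hi => ?_).trans (by simp)
    have hi' : i ≤ n - 1 := Nat.le_sub_one_of_lt (Finset.mem_range.mp hi)
    rw [norm_mul, norm_pow, norm_pow]
    calc ‖w‖ ^ i * ‖v‖ ^ (n - 1 - i) ≤ M ^ i * M ^ (n - 1 - i) := by gcongr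
      _ = M ^ (n - 1) := by rw [← pow_add, Nat.add_sub_cancel' hi']
  nlinarith [norm_nonneg (w - v)]

theorem continuous_saddleFactor {y : ℝ} (hy : 0 < y) : Continuous (saddleFactor y) := by
  unfold saddleFactor
  exact (by fun_prop : Continuous fun x : ℝ => Complex.exp (-(Complex.I * (x / y : ℝ)) / 2) * √y).mul
    (continuous_jacobiTheta₂_line 0 hy)

/-- Used with `t = √d s`: half of the decay `e^{-t²/16}` absorbs the cubic error. -/
theorem abs_pow_three_le_exp (t : ℝ) : |t| ^ 3 ≤ 2100 * Real.exp (t ^ 2 / 32) := by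
  have h1 : |t| ^ 3 ≤ 1 + t ^ 4 := by
    rcases le_total (|t|) 1 with h | h
    · have h2 : |t| ^ 3 ≤ 1 := pow_le_one₀ (abs_nonneg t) h
      have : 0 ≤ t ^ 4 := by positivity
      linarith
    · have h2 : |t| ^ 3 ≤ |t| ^ 4 := pow_le_pow_right₀ h (by norm_num)
      have : |t| ^ 4 = t ^ 4 := by
        rw [show |t| ^ 4 = (|t| ^ 2) ^ 2 by ring, sq_abs]; ring
      linarith
  have h2 := Real.quadratic_le_exp_of_nonneg (x := t ^ 2 / 32) (by positivity)
  have h3 : 0 ≤ t ^ 2 := sq_nonneg t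
  have h4 : t ^ 4 = (t ^ 2) ^ 2 := by ring
  nlinarith

/-- Telescoping costs a factor `d`, but on the Gaussian scale `|s| ~ d^{-1/2}` the error `d|s|³` is
only of order `d^{-1/2}`. -/
theorem norm_saddleFactor_pow_sub_le {d : ℕ} (hd : 2 ≤ d) {x y : ℝ} (hy : 0 < y) (hx : |x| ≤ y)
    (hyd : 24 * y ≤ 1 / (d : ℝ) ^ 2) :
    ‖saddleFactor y x ^ d - (Real.exp (-(x / y) ^ 2 / 4) : ℂ) ^ d‖ ≤
      110000 / √d * Real.exp (-(d / 32 * (x / y) ^ 2)) := by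
  have hd' : (2 : ℝ) ≤ d := by exact_mod_cast hd
  set η : ℝ := 1 / (d : ℝ) ^ 2 with hη
  have hη0 : 0 < η := by positivity
  have hη1 : η ≤ 1 := by rw [hη, div_le_one (by positivity)]; nlinarith
  set s := x / y with hs
  set M := Real.exp (-s ^ 2 / 8) * (1 + η) with hM
  have hw : ‖saddleFactor y x‖ ≤ M := by
    have h := sqrt_mul_norm_jacobiTheta₂_le 0 hy hx hyd hη1
    have h0 : ‖((0 : ℝ) : UnitAddCircle)‖ = 0 := by simp
    rw [h0] at h
    simp only [ne_eq, OfNat.ofNat_ne_zero, not_false_eq_true, zero_pow, mul_zero, zero_div,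
      Real.exp_zero, mul_one, Complex.ofReal_zero] at h
    have hph : ‖Complex.exp (-(Complex.I * (s : ℝ)) / 2)‖ = 1 := by
      rw [show -(Complex.I * (s : ℂ)) / 2 = ((-s / 2 : ℝ) : ℂ) * Complex.I by push_cast; ring,
        Complex.norm_exp_ofReal_mul_I]
    rw [saddleFactor, norm_mul, norm_mul, hph, one_mul, Complex.norm_real,
      Real.norm_of_nonneg (Real.sqrt_nonneg y)]
    exact h
  have hv : ‖(Real.exp (-s ^ 2 / 4) : ℂ)‖ ≤ M := by
    rw [Complex.norm_real, Real.norm_of_nonneg (Real.exp_pos _).le, hM]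
    have h1 : Real.exp (-s ^ 2 / 4) ≤ Real.exp (-s ^ 2 / 8) :=
      Real.exp_le_exp.mpr (by linarith [sq_nonneg s])
    nlinarith [Real.exp_pos (-s ^ 2 / 8)]
  have hMp : M ^ (d - 1) ≤ 3 * Real.exp (-(d / 16 * s ^ 2)) := by
    rw [hM, mul_pow, mul_comm, ← Real.exp_nat_mul]
    gcongr
    · exact one_add_inv_sq_pow_le (by omega) (by omega)
    · have : ((d - 1 : ℕ) : ℝ) = d - 1 := by rw [Nat.cast_sub (by omega)]; simp
      rw [this]
      nlinarith [sq_nonneg s]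
  have hsd : 0 < √(d : ℝ) := Real.sqrt_pos.mpr (by linarith)
  have hsq : √(d : ℝ) ^ 2 = d := Real.sq_sqrt (by linarith)
  have hsd1 : 1 ≤ √(d : ℝ) := Real.one_le_sqrt.mpr (by linarith)
  have hcube : (d : ℝ) * |s| ^ 3 ≤ 2100 / √d * Real.exp (d / 32 * s ^ 2) := by
    have h1 := abs_pow_three_le_exp (√d * s)
    rw [abs_mul, abs_of_pos hsd, mul_pow, mul_pow, hsq] at h1
    rw [div_mul_eq_mul_div, le_div_iff₀ hsd]
    calc (d : ℝ) * |s| ^ 3 * √d = √d ^ 3 * |s| ^ 3 := by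
          rw [show √(d : ℝ) ^ 3 = √d ^ 2 * √d by ring, hsq]; ring
      _ ≤ _ := h1
      _ = _ := by ring_nf
  have hdη : (d : ℝ) * η ≤ 1 / √d * Real.exp (d / 32 * s ^ 2) := by
    have h1 : (d : ℝ) * η = 1 / d := by rw [hη]; field_simp
    have h2 : 1 / (d : ℝ) ≤ 1 / √d := by
      apply one_div_le_one_div_of_le hsd
      nlinarith
    have h3 : 1 ≤ Real.exp (d / 32 * s ^ 2) := Real.one_le_exp (by positivity)
    have h4 : 0 < 1 / √(d : ℝ) := by positivity
    rw [h1]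
    nlinarith
  have hexp : Real.exp (d / 32 * s ^ 2) * Real.exp (-(d / 16 * s ^ 2)) =
      Real.exp (-(d / 32 * s ^ 2)) := by
    rw [← Real.exp_add]; congr 1; ring
  calc ‖saddleFactor y x ^ d - (Real.exp (-s ^ 2 / 4) : ℂ) ^ d‖
      ≤ d * ‖saddleFactor y x - Real.exp (-s ^ 2 / 4)‖ * M ^ (d - 1) := norm_pow_sub_pow_le hw hv d
    _ ≤ d * (16 * |s| ^ 3 + η) * (3 * Real.exp (-(d / 16 * s ^ 2))) := by
        gcongr
        exact norm_saddleFactor_sub_gaussian_le hy hx hyd hη1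
    _ = (16 * (d * |s| ^ 3) + d * η) * (3 * Real.exp (-(d / 16 * s ^ 2))) := by ring
    _ ≤ (16 * (2100 / √d * Real.exp (d / 32 * s ^ 2)) + 1 / √d * Real.exp (d / 32 * s ^ 2)) *
          (3 * Real.exp (-(d / 16 * s ^ 2))) := by gcongr
    _ = 100803 / √d * (Real.exp (d / 32 * s ^ 2) * Real.exp (-(d / 16 * s ^ 2))) := by ring
    _ ≤ 110000 / √d * Real.exp (-(d / 32 * s ^ 2)) := by
        rw [hexp]
        gcongr
        norm_num

/-- Lower bound for the contribution of the saddle point. -/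
theorem norm_integral_saddleFactor_pow_ge {d : ℕ} (hd : 2 ≤ d) {y : ℝ} (hy : 0 < y)
    (hyd : 24 * y ≤ 1 / (d : ℝ) ^ 2) :
    y / √d - 1210000 * y / d ≤ ‖∫ x in -y..y, saddleFactor y x ^ d‖ := by
  have hd' : (2 : ℝ) ≤ d := by exact_mod_cast hd
  have hsd : 0 < √(d : ℝ) := Real.sqrt_pos.mpr (by linarith)
  have hsd1 : 1 ≤ √(d : ℝ) := Real.one_le_sqrt.mpr (by linarith)
  have hsq : √(d : ℝ) ^ 2 = d := Real.sq_sqrt (by linarith)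
  have hcv : Continuous fun x : ℝ => Real.exp (-(x / y) ^ 2 / 4) ^ d := by fun_prop
  have hcw : Continuous fun x : ℝ => saddleFactor y x ^ d := (continuous_saddleFactor hy).pow d
  have hcv' : Continuous fun x : ℝ => (Real.exp (-(x / y) ^ 2 / 4) : ℂ) ^ d := by fun_prop
  have hmain : y / √d ≤ ∫ x in -y..y, Real.exp (-(x / y) ^ 2 / 4) ^ d := by
    set r := y / √d with hr
    have hr0 : 0 < r := by positivity
    have hry : r ≤ y := div_le_self hy.le hsd1
    -- For `|x| ≤ y/√d` the exponent is at least `-1/4`, so the integrand is at least `1/2`.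
    calc r ≤ ∫ _x in -r..r, (1 / 2 : ℝ) := by
          rw [intervalIntegral.integral_const, smul_eq_mul]; linarith
      _ ≤ ∫ x in -r..r, Real.exp (-(x / y) ^ 2 / 4) ^ d := by
          refine intervalIntegral.integral_mono_on (by linarith) (by simp)
            (hcv.intervalIntegrable _ _) fun x hx => ?_
          rw [← Real.exp_nat_mul]
          have h1 : (d : ℝ) * (x / y) ^ 2 ≤ 1 := by
            have h2 : x ^ 2 ≤ r ^ 2 := sq_le_sq' hx.1 hx.2
            have h3 : r ^ 2 = y ^ 2 / d := by rw [hr, div_pow, hsq]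
            rw [h3, le_div_iff₀ (by linarith)] at h2
            rw [div_pow, mul_div_assoc', div_le_one (by positivity)]
            linarith
          have h4 := Real.add_one_le_exp ((d : ℝ) * (-(x / y) ^ 2 / 4))
          linarith
      _ ≤ ∫ x in -y..y, Real.exp (-(x / y) ^ 2 / 4) ^ d := by
          refine intervalIntegral.integral_mono_interval (by linarith) (by linarith) hry
            (Filter.Eventually.of_forall fun x => by positivity) (hcv.intervalIntegrable _ _)
  have herr : ‖(∫ x in -y..y, saddleFactor y x ^ d) -
      ∫ x in -y..y, (Real.exp (-(x / y) ^ 2 / 4) : ℂ) ^ d‖ ≤ 1210000 * y / d := by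
    rw [← intervalIntegral.integral_sub (hcw.intervalIntegrable _ _)
      (hcv'.intervalIntegrable _ _)]
    have h11 : √(Real.pi / ((d : ℝ) / 32)) ≤ 11 / √d := by
      rw [show Real.pi / ((d : ℝ) / 32) = (32 * Real.pi) / d by field_simp,
        Real.sqrt_div (by positivity)]
      gcongr
      rw [Real.sqrt_le_left (by norm_num)]
      linarith [Real.pi_lt_d2]
    calc _ ≤ ∫ x in -y..y, 110000 / √d * Real.exp (-(d / 32 * (x / y) ^ 2)) := by
          refine intervalIntegral.norm_integral_le_of_norm_le (by linarith)
            (Filter.Eventually.of_forall fun x hx => ?_)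
            (Continuous.intervalIntegrable (by fun_prop) _ _)
          exact norm_saddleFactor_pow_sub_le hd hy (abs_le.mpr ⟨hx.1.le, hx.2⟩) hyd
      _ = 110000 / √d * ∫ x in -y..y, Real.exp (-(d / 32 * (x / y) ^ 2)) :=
          intervalIntegral.integral_const_mul _ _
      _ ≤ 110000 / √d * (y * (11 / √d)) := by
          gcongr
          exact (intervalIntegral_gaussian_le hy (by positivity)).trans (by gcongr)
      _ = 1210000 * y / √d ^ 2 := by field_simp; norm_num
      _ = _ := by rw [hsq]
  have hnorm : y / √d ≤ ‖∫ x in -y..y, (Real.exp (-(x / y) ^ 2 / 4) : ℂ) ^ d‖ := by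
    have h1 : (∫ x in -y..y, (Real.exp (-(x / y) ^ 2 / 4) : ℂ) ^ d) =
        ((∫ x in -y..y, Real.exp (-(x / y) ^ 2 / 4) ^ d : ℝ) : ℂ) := by
      rw [← intervalIntegral.integral_ofReal]
      push_cast
      rfl
    rw [h1, Complex.norm_real]
    exact hmain.trans (le_abs_self _)
  have := norm_sub_norm_le (∫ x in -y..y, (Real.exp (-(x / y) ^ 2 / 4) : ℂ) ^ d)
    (∫ x in -y..y, saddleFactor y x ^ d)
  rw [norm_sub_rev] at this
  linarith

/-! ### Lattice sums as Fourier coefficients of theta products. -/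

theorem mem_latticeSphere_sqrt {d l : ℕ} (x : Fin d → ℤ) :
    x ∈ latticeSphere d (√(l : ℝ)) ↔ ∑ j, x j ^ 2 = (l : ℤ) := by
  rw [latticeSphere, Set.Finite.mem_toFinset, latticeSphereSet, mem_ofPred_eq,
    mem_sphere_zero_iff_norm, EuclideanSpace.norm_eq, Real.sqrt_inj (by positivity) (by positivity)]
  simp only [Real.norm_eq_abs, sq_abs]
  constructor
  · intro h; exact_mod_cast h
  · intro h; exact_mod_cast h

open Complex in
theorem integral_exp_int_mul (k : ℤ) (y : ℝ) :
    ∫ x in (-1 / 2 : ℝ)..3 / 2, cexp (Real.pi * I * k * (x + y * I)) =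
      if k = 0 then 2 else 0 := by
  split_ifs with hk
  · subst hk
    simp
    norm_num
  · have hk' : (k : ℂ) ≠ 0 := by exact_mod_cast hk
    have hc : (Real.pi * I * k : ℂ) ≠ 0 :=
      mul_ne_zero (mul_ne_zero (by exact_mod_cast Real.pi_ne_zero) I_ne_zero) hk'
    simp only [mul_add, Complex.exp_add]
    rw [intervalIntegral.integral_mul_const, integral_exp_mul_complex hc]
    have : cexp (Real.pi * I * k * ((3 / 2 : ℝ) : ℂ)) =
        cexp (Real.pi * I * k * ((-1 / 2 : ℝ) : ℂ)) := by
      rw [Complex.exp_eq_exp_iff_exists_int]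
      refine ⟨k, ?_⟩
      push_cast; ring
    rw [this]
    simp

open Complex in
theorem prod_jacobiTheta₂_term {d : ℕ} (ξ : Fin d → ℝ) (n : Fin d → ℤ) (l : ℕ) (τ : ℂ) :
    cexp (-(Real.pi * I * l * τ)) * ∏ j, jacobiTheta₂_term (n j) (ξ j) τ =
      UnitAddTorus.mFourier n (fun j => (ξ j : UnitAddCircle)) *
        cexp (Real.pi * I * ((∑ j, n j ^ 2 - l : ℤ) : ℂ) * τ) := by
  have h1 : UnitAddTorus.mFourier n (fun j => (ξ j : UnitAddCircle)) =
      ∏ j, cexp (2 * Real.pi * I * n j * ξ j) := by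
    simp only [UnitAddTorus.mFourier, ContinuousMap.coe_mk]
    refine Finset.prod_congr rfl fun j _ => ?_
    rw [fourier_coe_apply]
    simp
  rw [h1, ← Complex.exp_sum]
  simp only [jacobiTheta₂_term]
  rw [← Complex.exp_sum, ← Complex.exp_add, ← Complex.exp_add, Finset.sum_add_distrib]
  congr 1
  push_cast
  rw [← Finset.sum_mul, ← Finset.mul_sum]
  ring

open Complex in
/-- The exponential sum over the lattice points of a sphere as a Fourier coefficient of a product
of theta functions. -/
theorem sum_latticeSphere_eq_integral {d : ℕ} (ξ : Fin d → ℝ) (l : ℕ) {y : ℝ} (hy : 0 < y) :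
    ∑ x ∈ latticeSphere d (√(l : ℝ)), UnitAddTorus.mFourier x (fun j => (ξ j : UnitAddCircle)) =
      1 / 2 * ∫ x in (-1 / 2 : ℝ)..3 / 2, cexp (-(Real.pi * I * l * (x + y * I))) *
        ∏ j, jacobiTheta₂ (ξ j) (x + y * I) := by
  set F : Finset ℤ → ℝ → ℂ := fun s x => cexp (-(Real.pi * I * l * (x + y * I))) *
    ∏ j, ∑ n ∈ s, jacobiTheta₂_term n (ξ j) (x + y * I) with hF
  have hterm : ∀ (n : ℤ) (u x : ℝ), ‖jacobiTheta₂_term n u (x + y * I)‖ =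
      Real.exp (-Real.pi * n ^ 2 * y) := by
    intro n u x
    rw [norm_jacobiTheta₂_term]; simp
  have him : ∀ x : ℝ, 0 < (x + y * I : ℂ).im := fun x => by simpa using hy
  have hsum : Summable fun n : ℤ => Real.exp (-Real.pi * n ^ 2 * y) := by
    simpa only [hterm] using (hasSum_jacobiTheta₂_term ((0 : ℝ) : ℂ) (him 0)).summable.norm
  have hlim : Filter.Tendsto (fun s => ∫ x in (-1 / 2 : ℝ)..3 / 2, F s x) Filter.atTop
      (nhds (∫ x in (-1 / 2 : ℝ)..3 / 2, cexp (-(Real.pi * I * l * (x + y * I))) *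
        ∏ j, jacobiTheta₂ (ξ j) (x + y * I))) := by
    refine intervalIntegral.tendsto_integral_filter_of_dominated_convergence
      (fun _ => Real.exp (Real.pi * l * y) * ∏ _j : Fin d, ∑' n : ℤ, Real.exp (-Real.pi * n ^ 2 * y))
      (Filter.Eventually.of_forall fun s => ?_)
      (Filter.Eventually.of_forall fun s => Filter.Eventually.of_forall fun x _ => ?_)
      (by simp) (Filter.Eventually.of_forall fun x _ => ?_)
    · apply Continuous.aestronglyMeasurable
      simp only [hF, jacobiTheta₂_term]
      fun_prop
    · rw [hF, norm_mul, norm_prod, Complex.norm_exp]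
      have h1 : (-(Real.pi * I * l * (x + y * I)) : ℂ).re = Real.pi * l * y := by
        simp
      rw [h1]
      gcongr with j
      refine (norm_sum_le _ _).trans ?_
      simp only [hterm]
      exact hsum.sum_le_tsum s fun _ _ => (Real.exp_pos _).le
    · refine Filter.Tendsto.const_mul _ (tendsto_finsetProd _ fun j _ => ?_)
      exact hasSum_jacobiTheta₂_term (ξ j) (him x)
  -- Once `s` contains `[-l, l]` the truncation captures the whole sphere, as `|n_j| ≤ n_j² ≤ l`;
  -- orthogonality removes every other term.
  have hconst : ∀ᶠ s : Finset ℤ in Filter.atTop, ∫ x in (-1 / 2 : ℝ)..3 / 2, F s x =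
      2 * ∑ x ∈ latticeSphere d (√(l : ℝ)),
        UnitAddTorus.mFourier x (fun j => (ξ j : UnitAddCircle)) := by
    filter_upwards [Filter.eventually_ge_atTop (Finset.Icc (-(l : ℤ)) l)] with s hs
    have hsub : latticeSphere d (√(l : ℝ)) ⊆ Fintype.piFinset fun _ : Fin d => s := by
      intro n hn
      rw [mem_latticeSphere_sqrt] at hn
      rw [Fintype.mem_piFinset]
      intro j
      apply hs
      have h1 : n j ^ 2 ≤ l := by
        rw [← hn]
        exact Finset.single_le_sum (f := fun j => n j ^ 2) (fun i _ => sq_nonneg _)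
          (Finset.mem_univ j)
      rw [Finset.mem_Icc]
      constructor <;> nlinarith
    have hF' : ∀ x : ℝ, F s x = ∑ n ∈ Fintype.piFinset fun _ : Fin d => s,
        UnitAddTorus.mFourier n (fun j => (ξ j : UnitAddCircle)) *
          cexp (Real.pi * I * ((∑ j, n j ^ 2 - l : ℤ) : ℂ) * (x + y * I)) := by
      intro x
      simp only [hF]
      rw [Finset.prod_univ_sum, Finset.mul_sum]
      exact Finset.sum_congr rfl fun n _ => prod_jacobiTheta₂_term ξ n l _
    simp only [hF']
    rw [intervalIntegral.integral_finsetSum fun n _ =>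
      Continuous.intervalIntegrable (by fun_prop) _ _]
    simp only [intervalIntegral.integral_const_mul, integral_exp_int_mul]
    rw [Finset.mul_sum, ← Finset.sum_subset hsub]
    · refine Finset.sum_congr rfl fun n hn => ?_
      rw [mem_latticeSphere_sqrt] at hn
      rw [if_pos (sub_eq_zero.mpr hn), mul_comm]
    · intro n _ hn
      rw [mem_latticeSphere_sqrt] at hn
      rw [if_neg fun h => hn (sub_eq_zero.mp h), mul_zero]
  have := tendsto_nhds_unique hlim (tendsto_const_nhds.congr' (hconst.mono fun _ h => h.symm))
  rw [this]
  ring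

/-! ### Splitting the period: numerator and denominator. -/

theorem intervalIntegral_eq_farSet_add {E : Type*} [NormedAddCommGroup E] [NormedSpace ℝ E]
    {f : ℝ → E} (hf : Continuous f) {y : ℝ} (hy : 0 < y) (hy2 : y ≤ 1 / 2) :
    ∫ x in (-1 / 2 : ℝ)..3 / 2, f x =
      (∫ x in farSet y, f x) + ((∫ x in -y..y, f x) + ∫ x in 1 - y..1 + y, f x) := by
  have hI : IntegrableOn f (Icc (-1 / 2) (3 / 2)) := hf.continuousOn.integrableOn_Icc
  have hI0 : IntegrableOn f (Ioo (-y) y) :=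
    (hf.continuousOn.integrableOn_Icc (a := -y) (b := y)).mono_set Ioo_subset_Icc_self
  have hI1 : IntegrableOn f (Ioo (1 - y) (1 + y)) :=
    (hf.continuousOn.integrableOn_Icc (a := 1 - y) (b := 1 + y)).mono_set Ioo_subset_Icc_self
  have hdisj : Disjoint (Ioo (-y) y) (Ioo (1 - y) (1 + y)) := by
    rw [Set.disjoint_left]
    intro x h1 h2
    linarith [h1.2, h2.1]
  have hsub : Ioo (-y) y ∪ Ioo (1 - y) (1 + y) ⊆ Ioo (-1 / 2 : ℝ) (3 / 2) := by
    rintro x (h | h) <;> constructor <;> linarith [h.1, h.2]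
  rw [intervalIntegral.integral_of_le (by norm_num), intervalIntegral.integral_of_le (by linarith),
    intervalIntegral.integral_of_le (by linarith), ← integral_Icc_eq_integral_Ioc,
    integral_Ioc_eq_integral_Ioo, integral_Ioc_eq_integral_Ioo,
    ← setIntegral_union hdisj measurableSet_Ioo hI0 hI1, farSet, add_comm,
    ← integral_inter_add_sdiff (measurableSet_Ioo.union measurableSet_Ioo) hI,
    inter_eq_right.mpr (hsub.trans Ioo_subset_Icc_self)]

open Complex in
/-- The integrand of the circle method. -/
noncomputable def circleIntegrand {d : ℕ} (ξ : Fin d → ℝ) (l : ℕ) (y x : ℝ) : ℂ :=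
  cexp (-(Real.pi * I * l * (x + y * I))) * ∏ j, jacobiTheta₂ (ξ j) (x + y * I)

theorem continuous_circleIntegrand {d : ℕ} (ξ : Fin d → ℝ) (l : ℕ) {y : ℝ} (hy : 0 < y) :
    Continuous (circleIntegrand ξ l y) := by
  unfold circleIntegrand
  exact (by fun_prop : Continuous fun x : ℝ =>
    Complex.exp (-(Real.pi * Complex.I * l * (x + y * Complex.I)))).mul
    (continuous_finsetProd _ fun j _ => continuous_jacobiTheta₂_line _ hy)

/-- The size `e^{π l y} y^{-d/2}` of the integrand at the saddle point. -/
noncomputable def saddleHeight (d l : ℕ) (y : ℝ) : ℝ := Real.exp (Real.pi * l * y) / √y ^ d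

theorem norm_circleIntegrand {d : ℕ} (ξ : Fin d → ℝ) (l : ℕ) {y : ℝ} (hy : 0 < y) (x : ℝ) :
    ‖circleIntegrand ξ l y x‖ = saddleHeight d l y * thetaProd ξ y x := by
  have h1 : (-(Real.pi * Complex.I * l * (x + y * Complex.I)) : ℂ).re = Real.pi * l * y := by
    simp
  have hs : √y ≠ 0 := (Real.sqrt_pos.mpr hy).ne'
  rw [circleIntegrand, norm_mul, norm_prod, Complex.norm_exp, h1, saddleHeight, thetaProd]
  field_simp

/-- The condition `πly = d/2` turns `e^{-πilx}` into `(e^{-ix/(2y)})^d`, so the integrand is an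
exact `d`-th power up to `saddleHeight`. -/
theorem circleIntegrand_zero {d l : ℕ} {y : ℝ} (hy : 0 < y) (hdl : Real.pi * l * y = d / 2)
    (x : ℝ) : circleIntegrand (fun _ : Fin d => 0) l y x =
      saddleHeight d l y * saddleFactor y x ^ d := by
  have hs : (√y : ℂ) ≠ 0 := by exact_mod_cast (Real.sqrt_pos.mpr hy).ne'
  have hy0 : (y : ℂ) ≠ 0 := by exact_mod_cast hy.ne'
  have hdl' : (Real.pi * l * y : ℂ) = d / 2 := by 
    have := congrArg Complex.ofReal hdl
    push_cast at this
    exact this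
  have hexp : Complex.exp (-(Real.pi * Complex.I * l * (x + y * Complex.I))) =
      Complex.exp (Real.pi * l * y) * Complex.exp (-(Complex.I * (x / y : ℝ)) / 2) ^ d := by
    rw [← Complex.exp_nat_mul, ← Complex.exp_add]
    congr 1
    push_cast
    have h2 : (d : ℂ) * (-(Complex.I * (x / y)) / 2) = -(Complex.I * (x / y)) * (d / 2) := by ring
    rw [h2, ← hdl']
    field_simp
    linear_combination (-(l : ℂ) * y) * Complex.I_sq
  rw [circleIntegrand, saddleHeight, saddleFactor, hexp]
  simp only [Finset.prod_const, Finset.card_univ, Fintype.card_fin, Complex.ofReal_zero]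
  push_cast
  rw [mul_pow, mul_pow]
  field_simp

/-- The normalised contribution of everything away from the even integers. -/
noncomputable def remainderBound (C ρ : ℝ) (d : ℕ) : ℝ :=
  1210000 / √d + C * (√d * ρ ^ d) + 18 * Real.exp (-(d : ℝ))

theorem tendsto_remainderBound (C : ℝ) {ρ : ℝ} (h0 : 0 < ρ) (h1 : ρ < 1) :
    Filter.Tendsto (remainderBound C ρ) Filter.atTop (nhds 0) := by
  have hs : Filter.Tendsto (fun d : ℕ => √(d : ℝ)) Filter.atTop Filter.atTop :=
    Real.tendsto_sqrt_atTop.comp tendsto_natCast_atTop_atTop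
  have a1 : Filter.Tendsto (fun d : ℕ => 1210000 / √(d : ℝ)) Filter.atTop (nhds 0) :=
    hs.const_div_atTop _
  have a2 : Filter.Tendsto (fun d : ℕ => √(d : ℝ) * ρ ^ d) Filter.atTop (nhds 0) := by
    refine squeeze_zero' (Filter.Eventually.of_forall fun d => by positivity) ?_
      (tendsto_self_mul_const_pow_of_lt_one h0.le h1)
    filter_upwards [Filter.eventually_ge_atTop 1] with d hd
    have hd' : (1 : ℝ) ≤ d := by exact_mod_cast hd
    gcongr
    rw [Real.sqrt_le_left (by linarith)]
    nlinarith
  have a3 : Filter.Tendsto (fun d : ℕ => Real.exp (-(d : ℝ))) Filter.atTop (nhds 0) :=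
    (Real.tendsto_exp_neg_atTop_nhds_zero).comp tendsto_natCast_atTop_atTop
  unfold remainderBound
  simpa using (a1.add (a2.const_mul C)).add (a3.const_mul 18)

theorem norm_half_circle : ‖((1 / 2 : ℝ) : UnitAddCircle)‖ = 1 / 2 := by
  have := UnitAddCircle.norm_eq (x := (1 / 2 : ℝ))
  rw [this]
  norm_num [round_eq]

theorem norm_integral_circleIntegrand_le {C ρ : ℝ} {d l : ℕ} (hd : 1 ≤ d) (ξ : Fin d → ℝ) {y : ℝ}
    (hy : 0 < y) (hy2 : y ≤ 1 / 2) (hyd : 24 * y ≤ 1 / (d : ℝ) ^ 2)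
    (hfar : ∫ x in farSet y, thetaProd ξ y x ≤ C * ρ ^ d * y) :
    ‖∫ x in (-1 / 2 : ℝ)..3 / 2, circleIntegrand ξ l y x‖ ≤ saddleHeight d l y * (y / √d) *
      (C * (√d * ρ ^ d) +
        18 * Real.exp (-Real.pi * (∑ j, ‖(ξ j : UnitAddCircle)‖ ^ 2) / (4 * y)) +
        18 * Real.exp
          (-Real.pi * (∑ j, ‖((ξ j + 1 / 2 : ℝ) : UnitAddCircle)‖ ^ 2) / (4 * y))) := by
  have hsd : 0 < √(d : ℝ) := Real.sqrt_pos.mpr (by exact_mod_cast hd)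
  have hT : 0 ≤ saddleHeight d l y := by unfold saddleHeight; positivity
  have h0 := integral_thetaProd_near_zero_le hd ξ hy hyd
  have h1 := integral_thetaProd_near_one_le hd ξ hy hyd
  calc ‖∫ x in (-1 / 2 : ℝ)..3 / 2, circleIntegrand ξ l y x‖
      ≤ ∫ x in (-1 / 2 : ℝ)..3 / 2, ‖circleIntegrand ξ l y x‖ :=
        intervalIntegral.norm_integral_le_integral_norm (by norm_num)
    _ = saddleHeight d l y * ∫ x in (-1 / 2 : ℝ)..3 / 2, thetaProd ξ y x := by
        simp only [norm_circleIntegrand ξ l hy]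
        rw [intervalIntegral.integral_const_mul]
    _ ≤ saddleHeight d l y * (C * ρ ^ d * y +
          (18 * y / √d * Real.exp (-Real.pi * (∑ j, ‖(ξ j : UnitAddCircle)‖ ^ 2) / (4 * y)) +
          18 * y / √d * Real.exp
            (-Real.pi * (∑ j, ‖((ξ j + 1 / 2 : ℝ) : UnitAddCircle)‖ ^ 2) / (4 * y)))) := by
        rw [intervalIntegral_eq_farSet_add (continuous_thetaProd ξ hy) hy hy2]
        gcongr
    _ = _ := by
        generalize Real.exp (-Real.pi * (∑ j, ‖(ξ j : UnitAddCircle)‖ ^ 2) / (4 * y)) = a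
        generalize Real.exp
          (-Real.pi * (∑ j, ‖((ξ j + 1 / 2 : ℝ) : UnitAddCircle)‖ ^ 2) / (4 * y)) = b
        field_simp
        ring

/-- The arc around 0 dominates. Relative to `y/√d`, the three terms of `remainderBound` are the
Gaussian approximation error, the far set and the arc around 1. -/
theorem norm_integral_circleIntegrand_zero_ge {C ρ : ℝ} {d l : ℕ} (hd : 2 ≤ d) {y : ℝ}
    (hy : 0 < y) (hyd : 24 * y ≤ 1 / (d : ℝ) ^ 2) (hdl : Real.pi * l * y = d / 2)
    (hfar : ∫ x in farSet y, thetaProd (fun _ : Fin d => 0) y x ≤ C * ρ ^ d * y) :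
    saddleHeight d l y * (y / √d) * (1 - remainderBound C ρ d) ≤
      ‖∫ x in (-1 / 2 : ℝ)..3 / 2, circleIntegrand (fun _ : Fin d => 0) l y x‖ := by
  have hd' : (2 : ℝ) ≤ d := by exact_mod_cast hd
  have hsd : 0 < √(d : ℝ) := Real.sqrt_pos.mpr (by linarith)
  have hsq : √(d : ℝ) ^ 2 = d := Real.sq_sqrt (by linarith)
  have hT : 0 ≤ saddleHeight d l y := by unfold saddleHeight; positivity
  have hy24 : y ≤ 1 / 24 := by
    have : 1 / (d : ℝ) ^ 2 ≤ 1 := by rw [div_le_one (by positivity)]; nlinarith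
    linarith
  have hy2 : y ≤ 1 / 2 := by linarith
  set f := circleIntegrand (fun _ : Fin d => 0) l y with hf
  have hcf : Continuous f := continuous_circleIntegrand _ l hy
  have hmain : saddleHeight d l y * (y / √d - 1210000 * y / d) ≤ ‖∫ x in -y..y, f x‖ := by
    simp only [hf, circleIntegrand_zero hy hdl]
    rw [intervalIntegral.integral_const_mul, norm_mul, Complex.norm_real, Real.norm_of_nonneg hT]
    gcongr
    exact norm_integral_saddleFactor_pow_ge hd hy hyd
  have hfar' : ‖∫ x in farSet y, f x‖ ≤ saddleHeight d l y * (C * ρ ^ d * y) := by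
    refine (norm_integral_le_integral_norm _).trans ?_
    simp only [hf, norm_circleIntegrand _ l hy]
    rw [integral_const_mul]
    gcongr
  have hone : ‖∫ x in 1 - y..1 + y, f x‖ ≤
      saddleHeight d l y * (18 * y / √d * Real.exp (-(d : ℝ))) := by
    refine (intervalIntegral.norm_integral_le_integral_norm (by linarith)).trans ?_
    simp only [hf, norm_circleIntegrand _ l hy]
    rw [intervalIntegral.integral_const_mul]
    gcongr
    refine (integral_thetaProd_near_one_le (by omega) (fun _ : Fin d => 0) hy hyd).trans ?_
    gcongr
    -- Here `∑ⱼ dist(1/2, ℤ)² = d/4`, so the exponent is `-πd/(16y)`, below `-d` because `y ≤ 1/24`.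
    simp only [zero_add, norm_half_circle, Finset.sum_const, Finset.card_univ, Fintype.card_fin,
      nsmul_eq_mul]
    rw [div_le_iff₀ (by positivity)]
    nlinarith [Real.pi_gt_three]
  rw [intervalIntegral_eq_farSet_add hcf hy hy2]
  have htri : ‖∫ x in -y..y, f x‖ ≤ ‖(∫ x in farSet y, f x) +
      ((∫ x in -y..y, f x) + ∫ x in 1 - y..1 + y, f x)‖ + ‖∫ x in farSet y, f x‖ +
      ‖∫ x in 1 - y..1 + y, f x‖ := by
    set a := ∫ x in farSet y, f x
    set b := ∫ x in -y..y, f x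
    set c := ∫ x in 1 - y..1 + y, f x
    calc ‖b‖ = ‖(a + (b + c)) - a - c‖ := by congr 1; ring
      _ ≤ ‖a + (b + c)‖ + ‖a‖ + ‖c‖ :=
        (norm_sub_le _ _).trans (add_le_add (norm_sub_le _ _) le_rfl)
  have heq : saddleHeight d l y * (y / √d) * (1 - remainderBound C ρ d) =
      saddleHeight d l y * (y / √d - 1210000 * y / d) - saddleHeight d l y * (C * ρ ^ d * y) -
      saddleHeight d l y * (18 * y / √d * Real.exp (-(d : ℝ))) := by
    have h1 : 1210000 * y / (d : ℝ) = 1210000 * y / √d ^ 2 := by rw [hsq]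
    rw [h1, remainderBound]
    field_simp
    ring
  linarith

/-! ### The quotient and the final bounds. -/

/-- The common factor `1/2` cancels. Division by zero being zero, an empty sphere is covered too. -/
theorem multiplier_eq_div {d : ℕ} (ξ : Fin d → ℝ) (l : ℕ) {y : ℝ} (hy : 0 < y) :
    multiplier d (√(l : ℝ)) (fun j => (ξ j : UnitAddCircle)) =
      (∫ x in (-1 / 2 : ℝ)..3 / 2, circleIntegrand ξ l y x) /
        ∫ x in (-1 / 2 : ℝ)..3 / 2, circleIntegrand (fun _ : Fin d => 0) l y x := by
  have h1 := sum_latticeSphere_eq_integral ξ l hy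
  have h2 := sum_latticeSphere_eq_integral (fun _ : Fin d => 0) l hy
  have h3 : ∑ x ∈ latticeSphere d (√(l : ℝ)),
      UnitAddTorus.mFourier x (fun _ => ((0 : ℝ) : UnitAddCircle)) =
      ((latticeSphere d (√(l : ℝ))).card : ℂ) := by
    simp [UnitAddTorus.mFourier]
  rw [h3] at h2
  rw [multiplier, h1, h2]
  unfold circleIntegrand
  rw [one_div_mul_eq_div, mul_div_mul_left _ _ (by norm_num)]

theorem norm_multiplier_le_one (d : ℕ) (t : ℝ) (ξ : UnitAddTorus (Fin d)) :
    ‖multiplier d t ξ‖ ≤ 1 := by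
  have h1 : ‖∑ x ∈ latticeSphere d t, UnitAddTorus.mFourier x ξ‖ ≤ (latticeSphere d t).card := by
    refine (norm_sum_le_of_le (n := fun _ => (1 : ℝ)) _ fun x _ => ?_).trans (by simp)
    exact ((UnitAddTorus.mFourier x).norm_coe_le_norm ξ).trans UnitAddTorus.mFourier_norm.le
  rw [multiplier, norm_mul, norm_div, norm_one, Complex.norm_natCast, one_div_mul_eq_div]
  exact div_le_one_of_le₀ h1 (by positivity)

/-- From `(a - 2)² ≥ 0` and `e² ≤ 9`. The rate 2 matches the exponent `2πκ‖ξ‖` at `a = πκ‖ξ‖`. -/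
theorem exp_neg_sq_half_le (a : ℝ) : Real.exp (-(a ^ 2 / 2)) ≤ 9 * Real.exp (-2 * a) := by
  have h1 : Real.exp (-(a ^ 2 / 2)) ≤ Real.exp 1 ^ 2 * Real.exp (-2 * a) := by
    rw [← Real.exp_nat_mul, ← Real.exp_add]
    apply Real.exp_le_exp.mpr
    push_cast
    nlinarith [sq_nonneg (a - 2)]
  have h2 : Real.exp 1 ^ 2 ≤ 3 ^ 2 := by
    have := Real.exp_one_lt_d9
    gcongr
    linarith
  refine h1.trans ?_
  gcongr
  linarith

theorem exp_gaussian_le_exp_kappa {d l : ℕ} (hd : 0 < d) (hl : 0 < l) (ξ : UnitAddTorus (Fin d))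
    {y : ℝ} (hdl : Real.pi * l * y = d / 2) :
    Real.exp (-Real.pi * (∑ j, ‖ξ j‖ ^ 2) / (4 * y)) ≤
      9 * Real.exp (-2 * Real.pi * kappa d l * torusNorm ξ) := by
  have hd' : (0 : ℝ) < d := by exact_mod_cast hd
  have hl' : (0 : ℝ) < l := by exact_mod_cast hl
  have h := exp_neg_sq_half_le (Real.pi * kappa d l * torusNorm ξ)
  have h1 : -((Real.pi * kappa d l * torusNorm ξ) ^ 2 / 2) =
      -Real.pi * (∑ j, ‖ξ j‖ ^ 2) / (4 * y) := by
    have hy' : y = d / (2 * (Real.pi * l)) := by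
      have := Real.pi_pos
      field_simp
      linarith
    rw [mul_pow, mul_pow, kappa, torusNorm, Real.sq_sqrt (by positivity),
      Real.sq_sqrt (by positivity), hy']
    have := Real.pi_pos
    field_simp
    norm_num
  rw [h1] at h
  refine h.trans (le_of_eq ?_)
  ring_nf

theorem exists_multiplier_bound_of_large_dim : ∃ (c K : ℝ) (d₀ : ℕ), 0 < c ∧ 0 < K ∧
    ∀ d l : ℕ, 8 ≤ d → d₀ ≤ d → 4 * (d : ℝ) ^ 3 ≤ l → ∀ ξ : UnitAddTorus (Fin d),
      ‖multiplier d (√(l : ℝ)) ξ‖ ≤ K * (Real.exp (-2 * Real.pi * kappa d l * torusNorm ξ) +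
        Real.exp (-2 * Real.pi * kappa d l * torusNorm (ξ + halfVector d)) +
        Real.exp (-c * d)) := by
  obtain ⟨C, ρ, hC, hρ0, hρ1, hfar⟩ := exists_setIntegral_farSet_le
  obtain ⟨d₀, hd₀⟩ := Filter.eventually_atTop.mp
    ((tendsto_remainderBound C hρ0 hρ1).eventually_le_const (show (0 : ℝ) < 1 / 2 by norm_num))
  -- Thus `ρ^d = e^{-2cd}`; half of this decay absorbs `√d`.
  set c := -Real.log ρ / 2 with hc
  have hlog : Real.log ρ < 0 := Real.log_neg hρ0 hρ1
  have hc0 : 0 < c := by rw [hc]; linarith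
  -- `324 = 2 · 18 · 9`: 18 from the arcs, 9 from `exp_neg_sq_half_le`, and 2 because the
  -- denominator is at least `T / 2`.
  refine ⟨c, 324 + 2 * C / c, d₀, hc0, by positivity, fun d l hd hdd hl ξ => ?_⟩
  have hd' : (8 : ℝ) ≤ d := by exact_mod_cast hd
  have hl0 : (0 : ℝ) < l := lt_of_lt_of_le (by positivity) hl
  have hpi := Real.pi_gt_d2
  set y : ℝ := d / (2 * (Real.pi * l)) with hy
  have hy0 : 0 < y := by positivity
  have hdl : Real.pi * l * y = d / 2 := by rw [hy]; field_simp
  -- `24y = 12d/(πl) ≤ 3/(πd²)`; this is where `l ≥ 4d³` enters.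
  have hyd : 24 * y ≤ 1 / (d : ℝ) ^ 2 := by
    rw [hy, mul_div_assoc', div_le_div_iff₀ (by positivity) (by positivity)]
    nlinarith
  have hy2 : y ≤ 1 / 2 := by
    have : 1 / (d : ℝ) ^ 2 ≤ 1 := by rw [div_le_one (by positivity)]; nlinarith
    linarith
  have hsd : 0 < √(d : ℝ) := Real.sqrt_pos.mpr (by linarith)
  obtain ⟨u, hu⟩ : ∃ u : Fin d → ℝ, (fun j => (u j : UnitAddCircle)) = ξ := by
    choose u hu using fun j => QuotientAddGroup.mk_surjective (ξ j)
    exact ⟨u, funext hu⟩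
  have hu2 : (fun j => ((u j + 1 / 2 : ℝ) : UnitAddCircle)) = ξ + halfVector d := by
    rw [← hu]
    funext j
    rw [AddCircle.coe_add]
    rfl
  have hup := norm_integral_circleIntegrand_le (l := l) (by omega) u hy0 hy2 hyd
    (hfar d u y hd hy0 hy2)
  have hlow := norm_integral_circleIntegrand_zero_ge (by omega) hy0 hyd hdl
    (hfar d (fun _ => 0) y hd hy0 hy2)
  have hT : 0 < saddleHeight d l y * (y / √d) := by
    have : 0 < √y := Real.sqrt_pos.mpr hy0
    unfold saddleHeight; positivity
  set T := saddleHeight d l y * (y / √d) with hTdef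
  have hlow' : T / 2 ≤
      ‖∫ x in (-1 / 2 : ℝ)..3 / 2, circleIntegrand (fun _ : Fin d => 0) l y x‖ := by
    refine le_trans ?_ hlow
    have := hd₀ d hdd
    nlinarith
  have hlpos : 0 < l := by exact_mod_cast hl0
  have e1 := exp_gaussian_le_exp_kappa (by omega) hlpos ξ hdl
  have e2 := exp_gaussian_le_exp_kappa (by omega) hlpos (ξ + halfVector d) hdl
  have hs1 : ∑ j, ‖(u j : UnitAddCircle)‖ ^ 2 = ∑ j, ‖ξ j‖ ^ 2 :=
    Finset.sum_congr rfl fun j _ => by rw [← hu]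
  have hs2 : ∑ j, ‖((u j + 1 / 2 : ℝ) : UnitAddCircle)‖ ^ 2 = ∑ j, ‖(ξ + halfVector d) j‖ ^ 2 :=
    Finset.sum_congr rfl fun j _ => by rw [← hu2]
  rw [hs1, hs2] at hup
  have e3 : √(d : ℝ) * ρ ^ d ≤ 1 / c * Real.exp (-c * d) := by
    have h1 : ρ ^ d = Real.exp (-c * d) * Real.exp (-c * d) := by
      rw [← Real.exp_add, ← Real.exp_log (pow_pos hρ0 d), Real.log_pow, hc]
      congr 1; ring
    have h2 : √(d : ℝ) ≤ d := by
      rw [Real.sqrt_le_left (by linarith)]; nlinarith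
    have h3 : √(d : ℝ) * Real.exp (-c * d) ≤ 1 / c := by
      have h4 := Real.add_one_le_exp (c * d)
      have h5 : Real.exp (c * d) * Real.exp (-c * d) = 1 := by
        rw [← Real.exp_add, ← Real.exp_zero]; congr 1; ring
      rw [le_div_iff₀ hc0]
      have h6 : √(d : ℝ) * c ≤ Real.exp (c * d) := by nlinarith
      nlinarith [Real.exp_pos (-c * d)]
    rw [h1, ← mul_assoc]
    gcongr
  rw [← hu, multiplier_eq_div u l hy0, hu, norm_div]
  set X := Real.exp (-2 * Real.pi * kappa d l * torusNorm ξ)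
  set X' := Real.exp (-2 * Real.pi * kappa d l * torusNorm (ξ + halfVector d))
  have hX : 0 < X := Real.exp_pos _
  have hX' : 0 < X' := Real.exp_pos _
  have hZ : 0 < Real.exp (-c * d) := Real.exp_pos _
  rw [div_le_iff₀ (by linarith)]
  have hfin : C * (√d * ρ ^ d) + 18 * Real.exp (-Real.pi * (∑ j, ‖ξ j‖ ^ 2) / (4 * y)) +
      18 * Real.exp (-Real.pi * (∑ j, ‖(ξ + halfVector d) j‖ ^ 2) / (4 * y)) ≤
      (324 + 2 * C / c) * (X + X' + Real.exp (-c * d)) / 2 := by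
    have h1 : C * (√d * ρ ^ d) ≤ C / c * Real.exp (-c * d) := by
      calc _ ≤ C * (1 / c * Real.exp (-c * d)) := by gcongr
        _ = _ := by ring
    have h2 : 0 ≤ C / c * X := by positivity
    have h3 : 0 ≤ C / c * X' := by positivity
    have h4 : (324 + 2 * C / c) * (X + X' + Real.exp (-c * d)) / 2 =
        162 * X + 162 * X' + 162 * Real.exp (-c * d) + C / c * X + C / c * X' +
          C / c * Real.exp (-c * d) := by ring
    rw [h4]
    linarith
  calc _ ≤ T * ((324 + 2 * C / c) * (X + X' + Real.exp (-c * d)) / 2) :=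
        hup.trans (by gcongr)
    _ = (324 + 2 * C / c) * (X + X' + Real.exp (-c * d)) * (T / 2) := by ring
    _ ≤ _ := by gcongr

end DiscreteSphere

theorem proposition4p4 :
    ∃ C c K : ℝ, 0 < C ∧ 0 < c ∧ 0 < K ∧
      ∀ (d l : ℕ), 16 ≤ d → C * (d : ℝ) ^ 3 ≤ (l : ℝ) →
        ∀ ξ : UnitAddTorus (Fin d),
          ‖DiscreteSphere.multiplier d (Real.sqrt (l : ℝ)) ξ‖ ≤
            K * (Real.exp (-2 * Real.pi * DiscreteSphere.kappa d l *
                    DiscreteSphere.torusNorm ξ) +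
                Real.exp (-2 * Real.pi * DiscreteSphere.kappa d l *
                    DiscreteSphere.torusNorm (ξ + DiscreteSphere.halfVector d)) +
                1 / (l : ℝ) ^ 2 +
                Real.exp (-c * (d : ℝ))) := by
  obtain ⟨c, K, d₀, hc, hK, h⟩ := DiscreteSphere.exists_multiplier_bound_of_large_dim
  -- The summand `e^{c d₀}` pays for `d < d₀`, where `|𝔪_t| ≤ 1 ≤ e^{c d₀} e^{-cd}`.
  refine ⟨4, c, K + Real.exp (c * d₀), by norm_num, hc, by positivity, fun d l hd hl ξ => ?_⟩
  set X := Real.exp (-2 * Real.pi * DiscreteSphere.kappa d l * DiscreteSphere.torusNorm ξ)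
  set X' := Real.exp (-2 * Real.pi * DiscreteSphere.kappa d l *
    DiscreteSphere.torusNorm (ξ + DiscreteSphere.halfVector d))
  have hX : 0 < X := Real.exp_pos _
  have hX' : 0 < X' := Real.exp_pos _
  have hl2 : 0 ≤ 1 / (l : ℝ) ^ 2 := by positivity
  rcases le_or_gt d₀ d with hdd | hdd
  · refine (h d l (by omega) hdd hl ξ).trans ?_
    refine mul_le_mul (by linarith [Real.exp_pos (c * d₀)]) (by linarith) (by positivity)
      (by positivity)
  · refine (DiscreteSphere.norm_multiplier_le_one d _ ξ).trans ?_
    have h1 : 1 ≤ Real.exp (c * d₀) * Real.exp (-c * d) := by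
      rw [← Real.exp_add]
      apply Real.one_le_exp
      have : (d : ℝ) ≤ d₀ := by exact_mod_cast hdd.le
      nlinarith
    exact h1.trans (mul_le_mul (by linarith) (by linarith) (by positivity) (by positivity))
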